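/- Let $I=[a,b]\subset\mathbb{R}$ be a compact interval and let $f\colon I\to I$ be a unimodal map with turning point $c$; that is, $f$ is continuous, $a<c<b$, and $f$ is strictly monotone on $[a,c]$ and on $[c,b]$, increasing on one of these intervals and decreasing on the other. A point $x\in I$ is periodic if $f^n(x)=x$ for some $n\ge 1$, and the least such $n$ is its minimal period. A periodic point $x$ of minimal period $n$ is repelling if there is an open neighbourhood $U$ of $x$ in $I$ such that for every $y\in U\setminus\{x\}$ there is $k\in\mathbb{N}$ with $f^{nk}(y)\notin U$. A point $y\in I$ is asymptotic to a periodic orbit if there are a periodic point $x$, of minimal period $n$, and $m\in\mathbb{N}$ with $\lim_{k\to\infty}f^{kn+m}(y)=x$. Suppose that all but finitely many of the periodic points of $f$ are repelling. Then $f^n$ has only finitely many fixed points for every $n\ge 1$, so the Artin–Mazur zeta function $$\zeta_f(t)=\exp\Bigl(\sum_{n\ge 1}\frac{N_n(f)}{n}\,t^n\Bigr)\in\mathbb{Q}[[t]],$$ where $N_n(f)$ is the number of isolated fixed points of $f^n$, is well defined; and $\zeta_f$ is a rational function, i.e. $Q\,\zeta_f=P$ for some polynomials $P,Q\in\mathbb{Q}[t]$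 with $Q\neq 0$, if and only if the turning point $c$ is asymptotic to a periodic orbit of $f$. -/

import Mathlib

namespace IntervalZeta

open Filter Topology

section Dynamics

variable {X : Type*} [TopologicalSpace X]

/-- The periodic point `x`, of minimal period `n`, is repelling: it has an open neighbourhood `U`
such that every `y ∈ U` other than `x` is eventually moved out of `U` by an iterate of `f^n`. -/
def IsRepelling (f : X → X) (x : X) : Prop :=
  x ∈ Function.periodicPts f ∧
    ∃ U : Set X, IsOpen U ∧ x ∈ U ∧
      ∀ y ∈ U, y ≠ x → ∃ k : ℕ, f^[Function.minimalPeriod f x * k] y ∉ U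

/-- The point `y` is asymptotic to some periodic orbit of `f`: there are a periodic point `x`, of
minimal period `n`, and `m ∈ ℕ` such that `f^(k n + m) (y) → x` as `k → ∞`. -/
def IsAsymptoticToPeriodicOrbit (f : X → X) (y : X) : Prop :=
  ∃ x ∈ Function.periodicPts f, ∃ m : ℕ,
    Tendsto (fun k : ℕ => f^[k * Function.minimalPeriod f x + m] y) atTop (𝓝 x)

/-- The set of isolated fixed points of `f^n`, i.e. isolated points of the set of its fixed
points. -/
def isolatedFixedPts (f : X → X) (n : ℕ) : Set X :=
  {x | x ∈ Function.fixedPoints f^[n] ∧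
    ∃ U : Set X, IsOpen U ∧ x ∈ U ∧ ∀ y ∈ U, y ∈ Function.fixedPoints f^[n] → y = x}

/-- The formal power series `∑_{n ≥ 1} (N_n(f) / n) t^n`, where `N_n(f)` is the number of isolated
fixed points of `f^n`. -/
noncomputable def logZeta (f : X → X) : PowerSeries ℚ :=
  PowerSeries.mk fun n => if n = 0 then 0 else ((isolatedFixedPts f n).ncard : ℚ) / n

/-- `logZeta f` has zero constant term, so it may be substituted into any formal power series. -/
theorem hasSubst_logZeta (f : X → X) : PowerSeries.HasSubst (logZeta f) :=
  PowerSeries.HasSubst.of_constantCoeff_zero' (by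
    rw [← PowerSeries.coeff_zero_eq_constantCoeff_apply]; simp [logZeta])

/-- The Artin–Mazur zeta function of `f`: the formal power series
`exp (∑_{n ≥ 1} (N_n(f) / n) t^n)`. It is the intended object when every `f^n`, `n ≥ 1`, has only
finitely many fixed points. -/
noncomputable def artinMazurZeta (f : X → X) : PowerSeries ℚ :=
  (PowerSeries.exp ℚ).subst (logZeta f)

end Dynamics

/-- A formal power series is (the expansion of) a rational function `P / Q`. -/
def IsRationalSeries (F : PowerSeries ℚ) : Prop :=
  ∃ P Q : Polynomial ℚ, Q ≠ 0 ∧ (Q : PowerSeries ℚ) * F = (P : PowerSeries ℚ)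

/-- `f : [a, b] → [a, b]` is unimodal with turning point `c`: it is continuous, `a < c < b`, and `f`
is strictly monotone on `[a, c]` and on `[c, b]`, in opposite directions. -/
structure IsUnimodal {a b : ℝ} (f : Set.Icc a b → Set.Icc a b) (c : Set.Icc a b) : Prop where
  continuous : Continuous f
  left_lt : a < (c : ℝ)
  lt_right : (c : ℝ) < b
  monotone_pieces :
    (StrictMonoOn f (Set.Iic c) ∧ StrictAntiOn f (Set.Ici c)) ∨
      (StrictAntiOn f (Set.Iic c) ∧ StrictMonoOn f (Set.Ici c))

end IntervalZeta

/-! Write `θ_n(g)` for `iterDir f c ω n g`, the orientation `±1` of `f^n` along a one-sided germ `g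
= (x, σ)`, and `F` for `germMap f c ω`. As a function of `g`, `θ_n` is a step function. It jumps
only at preimages of `c`, where the two sides are folded together, and summing the jumps gives
`IsTurning.iterDir_sub`.

Fixed points are counted by the same device. The product of `θ_n` with the sign of `f^n(y) - y`
jumps by 2 at each fixed point, less 2 for each attracting germ there; its other jumps lie at
preimages of `c`. Comparing its values at the two ends of the interval gives
`IsTurning.ncard_fixedPoints`. Let `D = ∑ θ_{n+1}(c,-1) t^n`. The chain rule `θ_{m+n}(g) = θ_m(g)
θ_n(F^m g)` collapses the resulting double sum to a derivative of `D`, so that `∑ N_n t^n = A + O -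
t D'/D`, where `A` counts attracting germs and `O` counts periodic points whose orbit meets `c`.
Both families are finite and are permuted by the dynamics, hence `A + O = -t Z'/Z` for a polynomial
`Z`, and `ζ D Z` is constant (`IsTurning.exists_zeta_mul_kneadingSeries`). The hypothesis on
repelling points makes both the fixed point sets and the set of attracting germs finite.

So `ζ` is rational exactly when `D` is. As `D` has coefficients `±1`, this means that they are
eventually periodic. In that case the sides of `c` visited by its orbit have an eventual period, so
some subsequence `f^(n₀ + kP)(c)` is monotone and converges to a periodic point. Conversely, an
orbit asymptotic to a cycle avoiding `c` eventually visits the sides of `c` periodically, and a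
periodic `c` has a finite orbit of germs. -/

namespace IntervalZeta

open Filter Topology

/-! ### One-sided germs and their neighbourhood filters -/

section Germs

variable {X : Type*}

/-- `DirLT σ x y` says that `y` lies on the side `σ` of `x`: to its right if `σ = 1`, to its left if
`σ = -1`. -/
def DirLT [LT X] (σ : ℤˣ) (x y : X) : Prop := if σ = 1 then x < y else y < x

theorem dirLT_one [LT X] {x y : X} : DirLT 1 x y ↔ x < y := by simp [DirLT]

theorem dirLT_neg_one [LT X] {x y : X} : DirLT (-1) x y ↔ y < x := by
  simp [DirLT, show (-1 : ℤˣ) ≠ 1 by decide]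

theorem dirLT_neg [LT X] {σ : ℤˣ} {x y : X} : DirLT (-σ) x y ↔ DirLT σ y x := by
  rcases Int.units_eq_one_or σ with rfl | rfl
  · rw [dirLT_neg_one, dirLT_one]
  · rw [neg_neg, dirLT_neg_one, dirLT_one]

theorem DirLT.trans [Preorder X] {σ : ℤˣ} {x y z : X} (h : DirLT σ x y) (h' : DirLT σ y z) :
    DirLT σ x z := by
  rcases Int.units_eq_one_or σ with rfl | rfl
  · rw [dirLT_one] at *; exact h.trans h'
  · rw [dirLT_neg_one] at *; exact h'.trans h

theorem DirLT.asymm [Preorder X] {σ : ℤˣ} {x y : X} (h : DirLT σ x y) : ¬ DirLT σ y x := by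
  rcases Int.units_eq_one_or σ with rfl | rfl
  · rw [dirLT_one] at *; exact h.asymm
  · rw [dirLT_neg_one] at *; exact h.asymm

theorem DirLT.ne [Preorder X] {σ : ℤˣ} {x y : X} (h : DirLT σ x y) : x ≠ y := by
  rintro rfl; exact h.asymm h

theorem dirLT_or_dirLT [LinearOrder X] (σ : ℤˣ) {x y : X} (h : x ≠ y) :
    DirLT σ x y ∨ DirLT σ y x := by
  rcases Int.units_eq_one_or σ with rfl | rfl
  · simpa only [dirLT_one] using lt_or_gt_of_ne h
  · simpa only [dirLT_neg_one] using (lt_or_gt_of_ne h).symm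

/-- The filter of one-sided neighbourhoods of `g.1` on the side `g.2`. -/
def side [LinearOrder X] [TopologicalSpace X] (g : X × ℤˣ) : Filter X :=
  𝓝[{y | DirLT g.2 g.1 y}] g.1

theorem side_one [LinearOrder X] [TopologicalSpace X] (x : X) : side (x, 1) = 𝓝[>] x := by
  simp only [side, dirLT_one]; rfl

theorem side_neg_one [LinearOrder X] [TopologicalSpace X] (x : X) : side (x, -1) = 𝓝[<] x := by
  simp only [side, dirLT_neg_one]; rfl

theorem side_le_nhds [LinearOrder X] [TopologicalSpace X] (g : X × ℤˣ) : side g ≤ 𝓝 g.1 :=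
  nhdsWithin_le_nhds

theorem eventually_side_dirLT [LinearOrder X] [TopologicalSpace X] (g : X × ℤˣ) :
    ∀ᶠ y in side g, DirLT g.2 g.1 y :=
  eventually_mem_nhdsWithin

theorem eventually_side_ne [LinearOrder X] [TopologicalSpace X] (g : X × ℤˣ) :
    ∀ᶠ y in side g, y ≠ g.1 :=
  (eventually_side_dirLT g).mono fun _ h => h.ne.symm

theorem eventually_nhds_of_side [LinearOrder X] [TopologicalSpace X] {x : X} {p : X → Prop}
    (h : ∀ σ, ∀ᶠ y in side (x, σ), p y) (hx : p x) : ∀ᶠ y in 𝓝 x, p y := by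
  have h1 := h 1
  have h2 := h (-1)
  rw [side_one, eventually_nhdsWithin_iff] at h1
  rw [side_neg_one, eventually_nhdsWithin_iff] at h2
  filter_upwards [h1, h2] with y h1 h2
  rcases lt_trichotomy x y with h | rfl | h
  exacts [h1 h, hx, h2 h]

section Side

variable [ConditionallyCompleteLinearOrder X] [TopologicalSpace X] [OrderTopology X]
  [DenselyOrdered X]

theorem side_neBot [BoundedOrder X] {g : X × ℤˣ} (h1 : g.1 ≠ ⊥) (h2 : g.1 ≠ ⊤) :
    (side g).NeBot := by
  obtain ⟨x, σ⟩ := g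
  rcases Int.units_eq_one_or σ with rfl | rfl
  · rw [side_one]
    exact nhdsGT_neBot_of_exists_gt ⟨⊤, lt_top_iff_ne_top.2 h2⟩
  · rw [side_neg_one]
    exact nhdsLT_neBot_of_exists_lt ⟨⊥, bot_lt_iff_ne_bot.2 h1⟩

/-- One-sided neighbourhoods have a basis of intervals with endpoint `g.1`. -/
theorem exists_interval_of_mem_side {g : X × ℤˣ} {s : Set X} (hs : s ∈ side g) :
    ∃ t ∈ side g, t ⊆ s ∧ IsPreconnected t ∧
      ∀ y ∈ t, ∀ z, DirLT g.2 g.1 z → DirLT g.2 z y → z ∈ t := by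
  obtain ⟨x, σ⟩ := g
  rcases Int.units_eq_one_or σ with rfl | rfl
  · by_cases hx : ∃ z, x < z
    · obtain ⟨z, hz⟩ := hx
      rw [side_one] at hs ⊢
      obtain ⟨v, hv, hvs⟩ := (mem_nhdsGT_iff_exists_Ioo_subset' hz).1 hs
      refine ⟨Set.Ioo x v, Ioo_mem_nhdsGT hv, hvs, isPreconnected_Ioo, ?_⟩
      intro y hy z h1 h2
      rw [dirLT_one] at h1 h2
      exact ⟨h1, h2.trans hy.2⟩
    · refine ⟨∅, ?_, Set.empty_subset _, isPreconnected_empty, by simp⟩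
      have : Set.Ioi x = ∅ := by
        ext z; simp only [Set.mem_Ioi, Set.mem_empty_iff_false, iff_false]; exact fun h => hx ⟨z, h⟩
      rw [side_one, this]; simp
  · by_cases hx : ∃ z, z < x
    · obtain ⟨z, hz⟩ := hx
      rw [side_neg_one] at hs ⊢
      obtain ⟨v, hv, hvs⟩ := (mem_nhdsLT_iff_exists_Ioo_subset' hz).1 hs
      refine ⟨Set.Ioo v x, Ioo_mem_nhdsLT hv, hvs, isPreconnected_Ioo, ?_⟩
      intro y hy z h1 h2
      rw [dirLT_neg_one] at h1 h2
      exact ⟨hy.1.trans h2, h1⟩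
    · refine ⟨∅, ?_, Set.empty_subset _, isPreconnected_empty, by simp⟩
      have : Set.Iio x = ∅ := by
        ext z; simp only [Set.mem_Iio, Set.mem_empty_iff_false, iff_false]; exact fun h => hx ⟨z, h⟩
      rw [side_neg_one, this]; simp

/-- Near a point with a neighbourhood free of fixed points on one side, a continuous map moves all
points of that side in the same direction. -/
theorem eventually_dirLT_or {g : X × ℤˣ} {φ : X → X} (hφ : Continuous φ)
    (h : ∀ᶠ y in side g, φ y ≠ y) (σ : ℤˣ) :
    (∀ᶠ y in side g, DirLT σ (φ y) y) ∨ ∀ᶠ y in side g, DirLT σ y (φ y) := by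
  obtain ⟨t, ht, hts, htc, -⟩ := exists_interval_of_mem_side h
  have key : (∀ y ∈ t, φ y < y) ∨ ∀ y ∈ t, y < φ y :=
    htc.subset_or_subset (isOpen_lt hφ continuous_id) (isOpen_lt continuous_id hφ)
      (Set.disjoint_left.2 fun y (h1 : φ y < y) (h2 : y < φ y) => h1.asymm h2)
      (fun y hy => lt_or_gt_of_ne (hts hy))
  rcases Int.units_eq_one_or σ with rfl | rfl
  · simp only [dirLT_one]
    exact key.imp (fun h => mem_of_superset ht h) (fun h => mem_of_superset ht h)
  · simp only [dirLT_neg_one]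
    exact key.symm.imp (fun h => mem_of_superset ht h) (fun h => mem_of_superset ht h)

end Side

/-! ### Step functions -/

/-- A function on germs is a step function if near each germ it is constant. -/
def IsStep [LinearOrder X] [TopologicalSpace X] {α : Type*} (h : X × ℤˣ → α) : Prop :=
  ∀ g, ∀ᶠ y in side g, ∀ σ, h (y, σ) = h g

theorem IsStep.map₂ [LinearOrder X] [TopologicalSpace X] {α β γ : Type*} {h : X × ℤˣ → α}
    {k : X × ℤˣ → β} (hh : IsStep h) (hk : IsStep k) (φ : α → β → γ) :
    IsStep fun g => φ (h g) (k g) := by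
  intro g
  filter_upwards [hh g, hk g] with y h1 h2 σ
  rw [h1, h2]

/-- `x` lies before the cut of the line given by the germ `g`. -/
def Before [LinearOrder X] (x : X) (g : X × ℤˣ) : Prop := x < g.1 ∨ (x = g.1 ∧ g.2 = 1)

theorem before_one [LinearOrder X] {x y : X} : Before x (y, 1) ↔ x ≤ y := by
  simp [Before, le_iff_lt_or_eq]

theorem before_neg_one [LinearOrder X] {x y : X} : Before x (y, -1) ↔ x < y := by
  simp [Before, show (-1 : ℤˣ) ≠ 1 by decide]

open Classical in
/-- The value of a step function is the sum of its jumps. -/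
theorem IsStep.sub_eq_sum [ConditionallyCompleteLinearOrder X] [TopologicalSpace X]
    [OrderTopology X] [DenselyOrdered X] [BoundedOrder X] {h : X × ℤˣ → ℤ} (hh : IsStep h)
    (T : Finset X) (hT : ∀ u ∉ T, h (u, 1) = h (u, -1)) (g : X × ℤˣ) :
    h g - h (⊥, -1) = ∑ u ∈ T with Before u g, (h (u, 1) - h (u, -1)) := by
  -- Subtracting the accumulated jumps leaves a step function with equal values on both sides of
  -- every point, hence a constant one by connectedness.
  set Φ : X × ℤˣ → ℤ := fun g => h g - ∑ u ∈ T with Before u g, (h (u, 1) - h (u, -1)) with hΦ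
  have h1 : ∀ y, Φ (y, 1) = Φ (y, -1) := by
    intro y
    simp only [hΦ, before_one, before_neg_one]
    by_cases hy : y ∈ T
    · have : T.filter (fun u => u ≤ y) = insert y (T.filter fun u => u < y) := by
        ext u; simp only [Finset.mem_filter, Finset.mem_insert, le_iff_eq_or_lt]
        constructor
        · rintro ⟨h1, h2⟩; tauto
        · rintro (rfl | h)
          · exact ⟨hy, Or.inl rfl⟩
          · tauto
      rw [this, Finset.sum_insert (by simp)]
      ring
    · rw [hT y hy]
      congr 2
      ext u; simp only [Finset.mem_filter, le_iff_eq_or_lt]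
      constructor
      · rintro ⟨h1, rfl | h2⟩
        · exact absurd h1 hy
        · exact ⟨h1, h2⟩
      · tauto
  have h2 : IsStep Φ := by
    rintro ⟨x, σ⟩
    have hfar : ∀ᶠ y in side (x, σ), ∀ u ∈ T, u ≠ x → (u < y ↔ u < x) := by
      rw [Filter.eventually_all_finset]
      intro u _
      by_cases hux : u = x
      · exact Eventually.of_forall fun y h => absurd hux h
      · refine Eventually.filter_mono (side_le_nhds (x, σ)) ?_
        rcases lt_or_gt_of_ne hux with h | h
        · filter_upwards [eventually_gt_nhds h] with y hy _
          exact ⟨fun _ => h, fun _ => hy⟩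
        · filter_upwards [eventually_lt_nhds h] with y hy _
          exact ⟨fun h' => absurd (h'.trans hy) (lt_irrefl _), fun h' => absurd h h'.asymm⟩
    have hT' : ∀ᶠ y in side (x, σ), ∀ u ∈ T, y ≠ u := by
      rw [Filter.eventually_all_finset]
      intro u _
      by_cases hux : u = x
      · rw [hux]; exact eventually_side_ne (x, σ)
      · exact Eventually.filter_mono (side_le_nhds (x, σ)) (eventually_ne_nhds (Ne.symm hux))
    filter_upwards [hh (x, σ), hfar, hT', eventually_side_dirLT (x, σ)] with y hy hf hyT hd τ
    simp only [hΦ, hy]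
    congr 2
    ext u
    simp only [Finset.mem_filter, and_congr_right_iff]
    intro hu
    have hne : u ≠ y := (hyT u hu).symm
    simp only [Before, hne, false_and, or_false]
    by_cases hux : u = x
    · subst hux
      rcases Int.units_eq_one_or σ with rfl | rfl
      · simpa [dirLT_one] using hd
      · simpa [dirLT_neg_one, show (-1 : ℤˣ) ≠ 1 by decide] using (dirLT_neg_one.1 hd).le
    · simp [hux, hf u hu hux]
  have h3 : IsLocallyConstant fun y => Φ (y, 1) := by
    rw [IsLocallyConstant.iff_eventually_eq]
    intro x
    refine eventually_nhds_of_side (fun σ => ?_) rfl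
    filter_upwards [h2 (x, σ)] with y hy
    rw [hy 1]
    rcases Int.units_eq_one_or σ with rfl | rfl
    exacts [rfl, (h1 x).symm]
  have h4 : Φ g = Φ (⊥, -1) := by
    obtain ⟨y, σ⟩ := g
    have := h3.apply_eq_of_preconnectedSpace y ⊥
    rcases Int.units_eq_one_or σ with rfl | rfl
    · rw [this, h1]
    · rw [← h1, this, h1]
  have h5 : Φ (⊥, -1) = h (⊥, -1) := by simp [hΦ, before_neg_one]
  rw [h5] at h4
  rw [← h4]; simp [hΦ]

end Germs

/-! ### The action of a unimodal map on germs -/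

section GermMap

variable {X : Type*} [ConditionallyCompleteLinearOrder X]

open Classical in
/-- The direction of the map along the germ `g`. -/
noncomputable def dir (c : X) (ω : ℤˣ) (g : X × ℤˣ) : ℤˣ :=
  if g.1 < c ∨ (g.1 = c ∧ g.2 = -1) then ω else -ω

/-- The action of a unimodal map on germs. -/
noncomputable def germMap (f : X → X) (c : X) (ω : ℤˣ) (g : X × ℤˣ) : X × ℤˣ :=
  (f g.1, g.2 * dir c ω g)

/-- The direction of the `n`-th iterate along the germ `g`. -/
noncomputable def iterDir (f : X → X) (c : X) (ω : ℤˣ) (n : ℕ) (g : X × ℤˣ) : ℤˣ :=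
  g.2 * ((germMap f c ω)^[n] g).2

/-- The closed side of `c` on which the map has direction `η`. -/
def branch (c : X) (ω η : ℤˣ) : Set X := {x | (η = ω ∧ x ≤ c) ∨ (η = -ω ∧ c ≤ x)}

variable {f : X → X} {c : X} {ω : ℤˣ}

theorem units_sq (σ : ℤˣ) : σ * σ = 1 := Int.units_mul_self σ

theorem dir_of_lt {x : X} (h : x < c) (σ : ℤˣ) : dir c ω (x, σ) = ω := by simp [dir, h]

theorem dir_of_gt {x : X} (h : c < x) (σ : ℤˣ) : dir c ω (x, σ) = -ω := by
  simp [dir, h.not_gt, h.ne']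

theorem dir_self (σ : ℤˣ) : dir c ω (c, σ) = -σ * ω := by
  rcases Int.units_eq_one_or σ with rfl | rfl <;> simp [dir, show (1 : ℤˣ) ≠ -1 by decide]

theorem mem_branch_dir (g : X × ℤˣ) : g.1 ∈ branch c ω (dir c ω g) := by
  unfold dir branch
  split_ifs with h
  · left; exact ⟨rfl, h.elim le_of_lt fun h => h.1.le⟩
  · right; push Not at h; exact ⟨rfl, h.1⟩

theorem mem_branch_or (x : X) : x ∈ branch c ω ω ∨ x ∈ branch c ω (-ω) :=
  (le_total x c).imp (fun h => Or.inl ⟨rfl, h⟩) fun h => Or.inr ⟨rfl, h⟩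

/-- The fold: both sides of `c` land on the same side of `f c`. -/
theorem germMap_turning (σ : ℤˣ) : germMap f c ω (c, σ) = (f c, -ω) := by
  unfold germMap
  rw [dir_self]
  simp only [Prod.mk.injEq, true_and]
  rw [← mul_assoc, mul_neg, units_sq, neg_one_mul]

theorem germMap_iterate_fst (n : ℕ) (g : X × ℤˣ) : ((germMap f c ω)^[n] g).1 = f^[n] g.1 := by
  induction n generalizing g with
  | zero => rfl
  | succ n ih => rw [Function.iterate_succ_apply, ih, Function.iterate_succ_apply]; rfl

theorem germMap_iterate_snd (n : ℕ) (g : X × ℤˣ) :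
    ((germMap f c ω)^[n] g).2 = g.2 * iterDir f c ω n g := by
  rw [iterDir, ← mul_assoc, units_sq, one_mul]

theorem germMap_iterate_eq (n : ℕ) (g : X × ℤˣ) :
    (germMap f c ω)^[n] g = (f^[n] g.1, g.2 * iterDir f c ω n g) :=
  Prod.ext (germMap_iterate_fst n g) (germMap_iterate_snd n g)

theorem iterDir_zero (g : X × ℤˣ) : iterDir f c ω 0 g = 1 := units_sq _

/-- The chain rule for orientations, which later merges products of kneading coefficients into
single ones. -/
theorem iterDir_add (m n : ℕ) (g : X × ℤˣ) :
    iterDir f c ω (m + n) g = iterDir f c ω m g * iterDir f c ω n ((germMap f c ω)^[m] g) := by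
  rw [iterDir, add_comm m n, Function.iterate_add_apply, germMap_iterate_snd, germMap_iterate_snd m,
    mul_assoc g.2, ← mul_assoc, units_sq, one_mul]

theorem iterDir_one (g : X × ℤˣ) : iterDir f c ω 1 g = dir c ω g := by
  simp only [iterDir, Function.iterate_one, germMap]
  rw [← mul_assoc, units_sq, one_mul]

theorem iterDir_succ (n : ℕ) (g : X × ℤˣ) :
    iterDir f c ω (n + 1) g = dir c ω g * iterDir f c ω n (germMap f c ω g) := by
  rw [add_comm, iterDir_add, iterDir_one, Function.iterate_one]

/-- The step after the visit to `c` forgets the side; `i < n` ensures that this step is taken. -/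
theorem germMap_iterate_eq_of_hit {n i : ℕ} {u : X} (h : f^[i] u = c) (hi : i < n) (σ τ : ℤˣ) :
    (germMap f c ω)^[n] (u, σ) = (germMap f c ω)^[n - i] (c, τ) := by
  obtain ⟨m, rfl⟩ : ∃ m, n = m + 1 + i := ⟨n - i - 1, by omega⟩
  rw [Function.iterate_add_apply, germMap_iterate_eq i, h, Function.iterate_succ_apply,
    germMap_turning, show m + 1 + i - i = m + 1 by omega, Function.iterate_succ_apply,
    germMap_turning]

theorem iterDir_eq_of_not_hit {n : ℕ} {u : X} (h : ∀ j < n, f^[j] u ≠ c) (σ τ : ℤˣ) :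
    iterDir f c ω n (u, σ) = iterDir f c ω n (u, τ) := by
  induction n with
  | zero => rw [iterDir_zero, iterDir_zero]
  | succ n ih =>
    rw [iterDir_add, iterDir_add, ih fun j hj => h j (by omega), iterDir_one, iterDir_one,
      germMap_iterate_eq, germMap_iterate_eq]
    congr 1
    rcases lt_or_gt_of_ne (h n (by omega)) with h | h
    · rw [dir_of_lt h, dir_of_lt h]
    · rw [dir_of_gt h, dir_of_gt h]

theorem iterDir_eq_of_hit {n i : ℕ} {u : X} (h : f^[i] u = c) (hi : i < n) (σ : ℤˣ) :
    iterDir f c ω n (u, σ) = -σ * iterDir f c ω (n - i) (c, -1) := by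
  rw [iterDir, germMap_iterate_eq_of_hit h hi σ (-1), germMap_iterate_snd]
  simp

/-- The two image germs coincide while the starting sides are opposite, so the orientations differ
by a sign; this is the source of the factor `-2`. -/
theorem jump_iterDir_of_hit {n i : ℕ} {u : X} (h : f^[i] u = c) (hi : i < n) :
    ((iterDir f c ω n (u, 1) : ℤ) - iterDir f c ω n (u, -1)) =
      -2 * (iterDir f c ω (n - i) (c, -1) : ℤ) := by
  rw [iterDir_eq_of_hit h hi, iterDir_eq_of_hit h hi]
  push_cast
  ring

variable [TopologicalSpace X]

/-- `f` is continuous and strictly monotone on either side of `c`, with direction `ω` on the left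
and `-ω` on the right. -/
structure IsTurning (f : X → X) (c : X) (ω : ℤˣ) : Prop where
  continuous : Continuous f
  left : ∀ x y, x < y → y ≤ c → DirLT ω (f x) (f y)
  right : ∀ x y, c ≤ x → x < y → DirLT (-ω) (f x) (f y)

theorem IsTurning.dirLT (hf : IsTurning f c ω) {η σ : ℤˣ} {x y : X} (hx : x ∈ branch c ω η)
    (hy : y ∈ branch c ω η) (h : DirLT σ x y) : DirLT (σ * η) (f x) (f y) := by
  have hω : ω ≠ -ω := by
    rcases Int.units_eq_one_or ω with rfl | rfl <;> decide
  rcases hx with ⟨rfl, hx⟩ | ⟨rfl, hx⟩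
  · replace hy : y ≤ c := by
      rcases hy with h | h
      exacts [h.2, absurd h.1 hω]
    rcases Int.units_eq_one_or σ with rfl | rfl
    · rw [one_mul]; exact hf.left x y (dirLT_one.1 h) hy
    · rw [neg_one_mul, dirLT_neg]; exact hf.left y x (dirLT_neg_one.1 h) hx
  · replace hy : c ≤ y := by
      rcases hy with h | h
      exacts [absurd h.1.symm hω, h.2]
    rcases Int.units_eq_one_or σ with rfl | rfl
    · rw [one_mul]; exact hf.right x y hx (dirLT_one.1 h)
    · rw [neg_one_mul, dirLT_neg]; exact hf.right y x hy (dirLT_neg_one.1 h)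

theorem IsTurning.ne_of_branch (hf : IsTurning f c ω) {η : ℤˣ} {x y : X} (hx : x ∈ branch c ω η)
    (hy : y ∈ branch c ω η) (h : x ≠ y) : f x ≠ f y := by
  rcases dirLT_or_dirLT 1 h with h | h
  · exact (hf.dirLT hx hy h).ne
  · exact (hf.dirLT hy hx h).ne.symm

variable [OrderTopology X]

theorem isStep_dir : IsStep (dir c ω) := by
  rintro ⟨x, σ⟩
  rcases lt_trichotomy x c with h | rfl | h
  · rw [dir_of_lt h]
    filter_upwards [Eventually.filter_mono (side_le_nhds (x, σ)) (eventually_lt_nhds h)] with y hy τ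
    exact dir_of_lt hy τ
  · filter_upwards [eventually_side_dirLT (x, σ)] with y hy τ
    rw [dir_self]
    rcases Int.units_eq_one_or σ with rfl | rfl
    · rw [dir_of_gt (dirLT_one.1 hy)]; simp
    · rw [dir_of_lt (dirLT_neg_one.1 hy)]; simp
  · rw [dir_of_gt h]
    filter_upwards [Eventually.filter_mono (side_le_nhds (x, σ)) (eventually_gt_nhds h)] with y hy τ
    exact dir_of_gt hy τ

theorem eventually_mem_branch (g : X × ℤˣ) : ∀ᶠ y in side g, y ∈ branch c ω (dir c ω g) := by
  filter_upwards [isStep_dir (c := c) (ω := ω) g] with y hy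
  have := mem_branch_dir (c := c) (ω := ω) (y, 1)
  rwa [hy] at this

theorem IsTurning.tendsto_side (hf : IsTurning f c ω) (g : X × ℤˣ) :
    Tendsto f (side g) (side (germMap f c ω g)) := by
  refine tendsto_nhdsWithin_iff.2 ⟨(hf.continuous.tendsto g.1).mono_left (side_le_nhds g), ?_⟩
  filter_upwards [eventually_mem_branch (c := c) (ω := ω) g, eventually_side_dirLT g] with y hy hd
  exact hf.dirLT (mem_branch_dir g) hy hd

theorem IsTurning.tendsto_side_iterate (hf : IsTurning f c ω) (n : ℕ) (g : X × ℤˣ) :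
    Tendsto f^[n] (side g) (side ((germMap f c ω)^[n] g)) := by
  induction n generalizing g with
  | zero => exact tendsto_id
  | succ n ih => exact (ih _).comp (hf.tendsto_side g)

/-- Along a germ, iterates of the map are strictly monotone. -/
theorem IsTurning.eventually_dirLT (hf : IsTurning f c ω) (n : ℕ) (g : X × ℤˣ) :
    ∀ᶠ p in side g ×ˢ side g, DirLT g.2 p.1 p.2 →
      DirLT ((germMap f c ω)^[n] g).2 (f^[n] p.1) (f^[n] p.2) := by
  induction n generalizing g with
  | zero => exact Eventually.of_forall fun p h => h
  | succ n ih =>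
    have hb := eventually_mem_branch (c := c) (ω := ω) g
    filter_upwards [((hf.tendsto_side g).prodMap (hf.tendsto_side g)).eventually (ih _),
      hb.prod_mk hb] with p h1 h2 h3
    exact h1 (hf.dirLT h2.1 h2.2 h3)

theorem IsTurning.isStep_iterDir (hf : IsTurning f c ω) (n : ℕ) : IsStep (iterDir f c ω n) := by
  induction n with
  | zero => exact fun g => Eventually.of_forall fun y σ => by rw [iterDir_zero, iterDir_zero]
  | succ n ih =>
    intro g
    filter_upwards [isStep_dir (c := c) (ω := ω) g, (hf.tendsto_side g).eventually (ih _)]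
      with y h1 h2 σ
    rw [iterDir_succ, iterDir_succ, h1]
    exact congrArg _ (h2 _)

end GermMap

/-! ### Preimages of the turning point and the kneading identity -/

section Kneading

variable {X : Type*} [ConditionallyCompleteLinearOrder X] [TopologicalSpace X]
  {f : X → X} {c : X} {ω : ℤˣ}

/-- The points whose orbit meets `c` for the first time at time `i`. -/
def firstHit (f : X → X) (c : X) (i : ℕ) : Set X := {u | f^[i] u = c ∧ ∀ j < i, f^[j] u ≠ c}

/-- `f` is injective on each of the two closed branches, so every preimage step preserves
finiteness. -/
theorem IsTurning.finite_preimage (hf : IsTurning f c ω) (i : ℕ) : {u | f^[i] u = c}.Finite := by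
  induction i with
  | zero => simp
  | succ i ih =>
    have h : ∀ η, (branch c ω η ∩ f ⁻¹' {u | f^[i] u = c}).Finite := fun η => by
      refine Set.Finite.of_finite_image (f := f) (ih.subset ?_) ?_
      · rintro _ ⟨x, hx, rfl⟩; exact hx.2
      · intro x hx y hy hxy
        by_contra hne
        exact hf.ne_of_branch hx.1 hy.1 hne hxy
    refine ((h ω).union (h (-ω))).subset fun u hu => ?_
    exact (mem_branch_or (c := c) (ω := ω) u).imp (fun h => ⟨h, hu⟩) fun h => ⟨h, hu⟩

theorem IsTurning.finite_firstHit (hf : IsTurning f c ω) (i : ℕ) : (firstHit f c i).Finite :=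
  (hf.finite_preimage i).subset fun _ h => h.1

/-- The number of points of `firstHit f c i` before the cut given by `g`. -/
noncomputable def hitCount (f : X → X) (c : X) (i : ℕ) (g : X × ℤˣ) : ℤ :=
  ({u ∈ firstHit f c i | Before u g}.ncard : ℤ)

/-- The points whose orbit meets `c` before time `n`. -/
noncomputable def IsTurning.hitSet (hf : IsTurning f c ω) (n : ℕ) : Finset X :=
  ((Set.finite_lt_nat n).biUnion fun i _ => hf.finite_preimage i).toFinset

theorem IsTurning.mem_hitSet (hf : IsTurning f c ω) {n : ℕ} {u : X} :
    u ∈ hf.hitSet n ↔ ∃ i < n, f^[i] u = c := by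
  simp [hitSet]

-- Sorting points by their first visit to `c` counts each of them once, even if the orbit returns to
-- `c`.
open Classical in
theorem IsTurning.sum_hitSet (hf : IsTurning f c ω) (n : ℕ) (φ : X → ℤ) :
    ∑ u ∈ hf.hitSet n, φ u = ∑ i ∈ Finset.range n, ∑ u ∈ (hf.finite_firstHit i).toFinset, φ u := by
  rw [← Finset.sum_biUnion]
  · congr 1
    ext u
    simp only [hf.mem_hitSet, Finset.mem_biUnion, Finset.mem_range, Set.Finite.mem_toFinset]
    constructor
    · rintro ⟨i, hi, hu⟩
      have hex : ∃ j, f^[j] u = c := ⟨i, hu⟩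
      exact ⟨Nat.find hex, (Nat.find_min' hex hu).trans_lt hi, Nat.find_spec hex,
        fun j hj => Nat.find_min hex hj⟩
    · rintro ⟨i, hi, hu⟩
      exact ⟨i, hi, hu.1⟩
  · intro i _ j _ hij
    simp only [Function.onFun]
    rw [Finset.disjoint_left]
    intro u hu hv
    rw [Set.Finite.mem_toFinset] at hu hv
    rcases lt_or_gt_of_ne hij with h | h
    · exact hv.2 i h hu.1
    · exact hu.2 j h hv.1

open Classical in
theorem IsTurning.hitCount_eq_sum (hf : IsTurning f c ω) (i : ℕ) (g : X × ℤˣ) :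
    hitCount f c i g =
      ∑ u ∈ (hf.finite_firstHit i).toFinset, if Before u g then (1 : ℤ) else 0 := by
  rw [Finset.sum_boole, hitCount, Set.ncard_eq_toFinset_card _
    ((hf.finite_firstHit i).subset (Set.sep_subset _ _))]
  congr 2
  ext u
  simp

variable [OrderTopology X] [DenselyOrdered X] [BoundedOrder X]

/-- The kneading identity. -/
theorem IsTurning.iterDir_sub (hf : IsTurning f c ω) (n : ℕ) (g : X × ℤˣ) :
    (iterDir f c ω n g : ℤ) - iterDir f c ω n (⊥, -1) =
      -2 * ∑ i ∈ Finset.range n, (iterDir f c ω (n - i) (c, -1) : ℤ) * hitCount f c i g := by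
  classical
  have hs : IsStep fun g => (iterDir f c ω n g : ℤ) :=
    (hf.isStep_iterDir n).map₂ (hf.isStep_iterDir n) fun a _ => (a : ℤ)
  rw [hs.sub_eq_sum (hf.hitSet n) _ g, Finset.sum_filter, hf.sum_hitSet, Finset.mul_sum]
  · refine Finset.sum_congr rfl fun i hi => ?_
    rw [hf.hitCount_eq_sum, Finset.mul_sum, Finset.mul_sum]
    refine Finset.sum_congr rfl fun u hu => ?_
    rw [Set.Finite.mem_toFinset] at hu
    rw [jump_iterDir_of_hit hu.1 (Finset.mem_range.1 hi)]
    split_ifs <;> ring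
  · intro u hu
    rw [hf.mem_hitSet] at hu
    push Not at hu
    rw [iterDir_eq_of_not_hit hu 1 (-1)]

end Kneading

/-! ### Repelling periodic points and finiteness of fixed points -/

section Repelling

theorem exists_nhds_forall_iterate_mem {X : Type*} [TopologicalSpace X] {f : X → X}
    (hf : Continuous f) {x : X} {p : ℕ} (hx : f^[p] x = x) (q : ℕ) {U : Set X} (hU : U ∈ 𝓝 x) :
    ∃ V ∈ 𝓝 x, ∀ y ∈ V, ∀ j < q, f^[p * j] y ∈ U := by
  refine ⟨⋂ j ∈ Finset.range q, f^[p * j] ⁻¹' U, ?_, ?_⟩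
  · rw [Filter.biInter_finset_mem]
    intro j _
    apply (hf.iterate _).continuousAt
    rwa [Function.IsPeriodicPt.mul_const (show Function.IsPeriodicPt f p x from hx) j]
  · intro y hy j hj
    simp only [Set.mem_iInter] at hy
    exact hy j (Finset.mem_range.2 hj)

/-- A repelling periodic point is a repelling fixed point of every iterate fixing it. -/
theorem IsRepelling.exists_nhds {X : Type*} [TopologicalSpace X] {f : X → X} (hf : Continuous f)
    {x : X} (h : IsRepelling f x) {n : ℕ} (hn : 1 ≤ n) (hx : f^[n] x = x) :
    ∃ V ∈ 𝓝 x, ∀ y ∈ V, y ≠ x → ∃ k, f^[n * k] y ∉ V := by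
  obtain ⟨-, U, hUo, hxU, hU⟩ := h
  set p := Function.minimalPeriod f x with hp
  have hpx : f^[p] x = x := Function.isPeriodicPt_minimalPeriod f x
  obtain ⟨q, rfl⟩ : p ∣ n := Function.IsPeriodicPt.minimalPeriod_dvd hx
  have hq : 0 < q := Nat.pos_of_ne_zero (by rintro rfl; simp at hn)
  -- With `n = p * q`, an `f^n`-orbit staying in `V` forces the whole `f^p`-orbit to stay in `U`.
  obtain ⟨V, hV, hVU⟩ := exists_nhds_forall_iterate_mem hf hpx q (hUo.mem_nhds hxU)
  refine ⟨V, hV, fun y hy hyx => ?_⟩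
  by_contra! hall
  obtain ⟨k, hk⟩ := hU y (by simpa using hVU y hy 0 hq) hyx
  refine hk ?_
  have := hVU _ (hall (k / q)) (k % q) (Nat.mod_lt _ hq)
  rwa [← Function.iterate_add_apply, mul_assoc, ← mul_add, Nat.mod_add_div] at this

variable {X : Type*} [ConditionallyCompleteLinearOrder X] [TopologicalSpace X] [OrderTopology X]
  [DenselyOrdered X] {f : X → X} {c : X} {ω : ℤˣ}

/-- An iterate is injective on intervals that contain no preimage of the turning point. -/
theorem IsTurning.exists_hit_of_eq (hf : IsTurning f c ω) {n : ℕ} {u v : X} (huv : u < v)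
    (h : f^[n] u = f^[n] v) : ∃ w ∈ Set.Ioo u v, ∃ i < n, f^[i] w = c := by
  induction n generalizing u v with
  | zero => exact absurd h huv.ne
  | succ n ih =>
    rw [Function.iterate_succ_apply, Function.iterate_succ_apply] at h
    have himg : ∀ w' ∈ Set.uIoo (f u) (f v), ∃ w ∈ Set.Ioo u v, f w = w' := by
      intro w' hw'
      rcases lt_or_ge (f u) (f v) with h1 | h1
      · rw [Set.uIoo_of_lt h1] at hw'
        exact intermediate_value_Ioo huv.le hf.continuous.continuousOn hw'
      · rw [Set.uIoo_of_ge h1] at hw'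
        exact intermediate_value_Ioo' huv.le hf.continuous.continuousOn hw'
    have pull : (∃ w ∈ Set.uIoo (f u) (f v), ∃ i < n, f^[i] w = c) →
        ∃ w ∈ Set.Ioo u v, ∃ i < n + 1, f^[i] w = c := by
      rintro ⟨w', hw', i, hi, hc⟩
      obtain ⟨w, hw, rfl⟩ := himg w' hw'
      exact ⟨w, hw, i + 1, by omega, hc⟩
    rcases lt_trichotomy (f u) (f v) with h1 | h1 | h1
    · exact pull (by rw [Set.uIoo_of_lt h1]; exact ih h1 h)
    -- Distinct points with equal images cannot share a closed branch, so `c` lies strictly between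
    -- them.
    · refine ⟨c, ⟨?_, ?_⟩, 0, by omega, rfl⟩
      · by_contra! hcu
        exact (hf.right u v hcu huv).ne h1
      · by_contra! hvc
        exact (hf.left u v huv hvc).ne h1
    · exact pull (by rw [Set.uIoo_of_gt h1]; exact ih h1 h.symm)

/-- If `φ` moves the points near the germ `g` towards its base point without crossing it, their
orbits stay close to the base point. -/
theorem exists_interval_forall_iterate_mem {φ : X → X} {g : X × ℤˣ}
    (h1 : ∀ᶠ y in side g, DirLT g.2 g.1 (φ y)) (h2 : ∀ᶠ y in side g, DirLT g.2 (φ y) y)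
    {V : Set X} (hV : V ∈ 𝓝 g.1) : ∀ᶠ y in side g, ∀ k, φ^[k] y ∈ V := by
  obtain ⟨t, ht, hts, -, hsub⟩ :=
    exists_interval_of_mem_side (inter_mem (inter_mem h1 h2) (side_le_nhds g hV))
  have hφ : ∀ y ∈ t, φ y ∈ t := fun y hy => hsub y hy _ (hts hy).1.1 (hts hy).1.2
  filter_upwards [ht] with y hy k
  have hk : φ^[k] y ∈ t := by
    induction k with
    | zero => exact hy
    | succ k ih => rw [Function.iterate_succ_apply']; exact hφ _ ih
  exact (hts hk).2

/-- Points moved inward without crossing the base point stay forever in any prescribed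
neighbourhood, which repulsion forbids. -/
theorem IsRepelling.not_attracting {g : X × ℤˣ} (hfc : Continuous f) (h : IsRepelling f g.1)
    [(side g).NeBot] {n : ℕ} (hn : 1 ≤ n) (hx : f^[n] g.1 = g.1)
    (h1 : ∀ᶠ y in side g, DirLT g.2 g.1 (f^[n] y)) :
    ¬ ∀ᶠ y in side g, DirLT g.2 (f^[n] y) y := by
  intro h2
  obtain ⟨V, hV, hrep⟩ := h.exists_nhds hfc hn hx
  obtain ⟨y, ⟨hy1, hy2⟩, hyV⟩ := ((exists_interval_forall_iterate_mem h1 h2 hV).and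
    (eventually_side_ne g)).and (side_le_nhds g hV) |>.exists
  obtain ⟨k, hk⟩ := hrep y hyV hy2
  rw [Function.iterate_mul] at hk
  exact hk (hy1 k)

/-- Two fixed points of an iterate are separated by a preimage of the turning point or by a periodic
point that is not repelling. -/
theorem IsTurning.exists_between_fixed (hf : IsTurning f c ω) {n : ℕ} (hn : 1 ≤ n) {y z : X}
    (hyz : y < z) (hy : f^[n] y = y) (hz : f^[n] z = z) :
    ∃ w ∈ Set.Icc y z, (∃ i < n, f^[i] w = c) ∨
      (w ∈ Function.periodicPts f ∧ ¬ IsRepelling f w) := by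
  by_contra! hno
  have hcont : Continuous f^[n] := hf.continuous.iterate n
  -- Without preimages of `c` the iterate is injective here, and the two fixed endpoints make it
  -- increasing.
  have hmono : StrictMonoOn f^[n] (Set.Icc y z) := by
    refine ContinuousOn.strictMonoOn_of_injOn_Icc hyz.le (by rw [hy, hz]; exact hyz.le)
      hcont.continuousOn ?_
    intro u hu v hv huv
    by_contra hne
    wlog hlt : u < v generalizing u v
    · exact this hv hu huv.symm (Ne.symm hne) (lt_of_le_of_ne (not_lt.1 hlt) (Ne.symm hne))
    obtain ⟨w, hw, i, hi, hc⟩ := hf.exists_hit_of_eq hlt huv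
    exact (hno w ⟨hu.1.trans hw.1.le, hw.2.le.trans hv.2⟩).1 i hi hc
  have hrep : ∀ w ∈ Set.Icc y z, f^[n] w = w → IsRepelling f w := fun w hw hfix =>
    (hno w hw).2 ⟨n, hn, hfix⟩
  have hyr := hrep y ⟨le_rfl, hyz.le⟩ hy
  have : (side (y, (1 : ℤˣ))).NeBot := by
    rw [side_one]; exact nhdsGT_neBot_of_exists_gt ⟨z, hyz⟩
  have hnear : ∀ᶠ w in side (y, (1 : ℤˣ)), w ∈ Set.Ioo y z := by
    rw [side_one]; exact Ioo_mem_nhdsGT hyz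
  have hup : ∀ᶠ w in side (y, (1 : ℤˣ)), DirLT 1 y (f^[n] w) := by
    filter_upwards [hnear] with w hw
    rw [dirLT_one]
    calc y = f^[n] y := hy.symm
      _ < f^[n] w := hmono ⟨le_rfl, hyz.le⟩ ⟨hw.1.le, hw.2.le⟩ hw.1
  have hiso : ∀ᶠ w in side (y, (1 : ℤˣ)), f^[n] w ≠ w := by
    obtain ⟨V, hV, hVr⟩ := hyr.exists_nhds hf.continuous hn hy
    filter_upwards [side_le_nhds _ hV, eventually_side_ne (y, (1 : ℤˣ))] with w hw hne hfix
    obtain ⟨k, hk⟩ := hVr w hw hne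
    rw [Function.IsPeriodicPt.mul_const (show Function.IsPeriodicPt f n w from hfix) k] at hk
    exact hk hw
  have hout : ∀ᶠ w in side (y, (1 : ℤˣ)), w < f^[n] w := by
    rcases eventually_dirLT_or hcont hiso 1 with h | h
    · exact absurd h (hyr.not_attracting (g := (y, 1)) hf.continuous hn hy hup)
    · simpa only [dirLT_one] using h
  obtain ⟨w₀, hw₀, hw₀I⟩ := (hout.and hnear).exists
  -- the first fixed point to the right of `w₀`
  set S : Set X := {w | w ∈ Set.Icc w₀ z ∧ f^[n] w ≤ w} with hS
  have hSne : S.Nonempty := ⟨z, ⟨hw₀I.2.le, le_rfl⟩, hz.le⟩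
  have hSbdd : BddBelow S := ⟨w₀, fun w hw => hw.1.1⟩
  have hSc : IsClosed S := isClosed_Icc.inter (isClosed_le hcont continuous_id)
  set v := sInf S with hv
  have hvS : v ∈ S := hSc.csInf_mem hSne hSbdd
  have hw₀v : w₀ < v := lt_of_le_of_ne hvS.1.1 fun h => by
    have := hvS.2
    rw [← h] at this
    exact absurd hw₀ this.not_gt
  have hbelow : ∀ w ∈ Set.Ioo w₀ v, w < f^[n] w := fun w hw => by
    by_contra! hle
    exact absurd (csInf_le hSbdd ⟨⟨hw.1.le, hw.2.le.trans hvS.1.2⟩, hle⟩) hw.2.not_ge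
  have hvI : v ∈ Set.Icc y z := ⟨hw₀I.1.le.trans hw₀v.le, hvS.1.2⟩
  have : (side (v, (-1 : ℤˣ))).NeBot := by
    rw [side_neg_one]; exact nhdsLT_neBot_of_exists_lt ⟨w₀, hw₀v⟩
  have hnear' : ∀ᶠ w in side (v, (-1 : ℤˣ)), w ∈ Set.Ioo w₀ v := by
    rw [side_neg_one]; exact Ioo_mem_nhdsLT hw₀v
  have hvfix : f^[n] v = v := by
    refine le_antisymm hvS.2 ?_
    have hlim : Tendsto f^[n] (side (v, (-1 : ℤˣ))) (𝓝 (f^[n] v)) :=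
      (hcont.tendsto v).mono_left (side_le_nhds (v, (-1 : ℤˣ)))
    exact le_of_tendsto_of_tendsto (tendsto_id'.2 (side_le_nhds (v, (-1 : ℤˣ)))) hlim
      (hnear'.mono fun w hw => (hbelow w hw).le)
  -- Just left of `v` points move up, and monotonicity keeps them below `v`: this side attracts.
  refine (hrep v hvI hvfix).not_attracting (g := (v, -1)) hf.continuous hn hvfix ?_ ?_
  · filter_upwards [hnear'] with w hw
    rw [dirLT_neg_one]
    calc f^[n] w < f^[n] v := hmono ⟨hw₀I.1.le.trans hw.1.le, hw.2.le.trans hvI.2⟩ hvI hw.2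
      _ = v := hvfix
  · filter_upwards [hnear'] with w hw
    rw [dirLT_neg_one]
    exact hbelow w hw

theorem IsTurning.finite_fixedPoints (hf : IsTurning f c ω)
    (hrep : {x ∈ Function.periodicPts f | ¬ IsRepelling f x}.Finite) {n : ℕ} (hn : 1 ≤ n) :
    (Function.fixedPoints f^[n]).Finite := by
  classical
  by_contra hinf
  set T : Finset X := hf.hitSet n ∪ hrep.toFinset with hT
  -- Removing `T` ensures that a separating point `w ≤ z` satisfies `w < z`.
  have hinf' : (Function.fixedPoints f^[n] \ (T : Set X)).Infinite :=
    Set.Infinite.sdiff hinf T.finite_toSet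
  -- Pigeonhole: infinitely many fixed points, but finitely many possible sets of elements of `T`
  -- below them.
  obtain ⟨y, hy, z, hz, hne, heq⟩ := hinf'.exists_ne_map_eq_of_mapsTo
    (f := fun x => T.filter (fun u => u < x)) (t := (T.powerset : Set (Finset X)))
    (fun x _ => Finset.mem_coe.2 (Finset.mem_powerset.2 (Finset.filter_subset _ _)))
    (Finset.finite_toSet _)
  wlog hlt : y < z generalizing y z
  · exact this z hz y hy hne.symm heq.symm (lt_of_le_of_ne (not_lt.1 hlt) hne.symm)
  obtain ⟨w, hw, h⟩ := hf.exists_between_fixed hn hlt hy.1 hz.1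
  have hwT : w ∈ T := by
    rw [hT, Finset.mem_union, hf.mem_hitSet, Set.Finite.mem_toFinset]
    exact h
  have hwz : w < z := lt_of_le_of_ne hw.2 fun h => hz.2 (h ▸ hwT)
  have hwy : w ∈ T.filter (fun u => u < y) := by
    have : w ∈ T.filter (fun u => u < z) := Finset.mem_filter.2 ⟨hwT, hwz⟩
    rwa [← heq] at this
  exact absurd hw.1 (Finset.mem_filter.1 hwy).2.not_ge

end Repelling

/-! ### Counting fixed points of iterates -/

section Counting

variable {X : Type*} [ConditionallyCompleteLinearOrder X] {f : X → X} {c : X} {ω : ℤˣ}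

theorem iterDir_of_fixed {n : ℕ} {g : X × ℤˣ} (h : (germMap f c ω)^[n] g = g) :
    iterDir f c ω n g = 1 := by
  rw [iterDir, h, units_sq]

theorem iterDir_of_not_fixed {n : ℕ} {g : X × ℤˣ} (h : f^[n] g.1 = g.1)
    (h' : (germMap f c ω)^[n] g ≠ g) : iterDir f c ω n g = -1 := by
  refine (Int.units_eq_one_or _).resolve_left fun h1 => h' ?_
  rw [germMap_iterate_eq, h1, mul_one, h]

open Classical in
/-- The sign telling on which side of `u` the germ `f^n u` lies. -/
noncomputable def beforeSign (f : X → X) (c : X) (ω : ℤˣ) (n : ℕ) (u : X) : ℤ :=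
  if Before u ((germMap f c ω)^[n] (u, 1)) then 1 else -1

/-- Both germs at `u` are sent to the same germ at `u`, so the sign of the jump agrees with the side
on which that germ lies. -/
theorem beforeSign_mul_jump_of_fixed {n : ℕ} {u : X} (h : f^[n] u = u)
    (hit : ∃ i < n, f^[i] u = c) :
    beforeSign f c ω n u * (iterDir f c ω n (u, 1) - iterDir f c ω n (u, -1)) = 2 := by
  obtain ⟨i, hi, hu⟩ := hit
  have key : iterDir f c ω n (u, -1) = -iterDir f c ω n (u, 1) := by
    rw [iterDir_eq_of_hit hu hi, iterDir_eq_of_hit hu hi]; simp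
  rw [beforeSign, germMap_iterate_eq, h, key]
  rcases Int.units_eq_one_or (iterDir f c ω n (u, 1)) with h1 | h1 <;> rw [h1]
  · simp [before_one]
  · simp [before_neg_one]

variable [TopologicalSpace X]

/-- `f^n` moves the points near the germ `g` towards its base point. On an empty side, for example
the left side of the least point, this holds vacuously. -/
def MovesInward (f : X → X) (n : ℕ) (g : X × ℤˣ) : Prop :=
  ∀ᶠ y in side g, DirLT g.2 (f^[n] y) y

open Classical in
/-- The direction in which `f^n` moves points near the germ `g`. -/
noncomputable def moveSign (f : X → X) (n : ℕ) (g : X × ℤˣ) : ℤˣ :=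
  if g.1 < f^[n] g.1 then 1 else if f^[n] g.1 < g.1 then -1 else
    if MovesInward f n g then -g.2 else g.2

/-- The germs that are fixed by `f^n` and attracting. -/
def attractingGerms (f : X → X) (c : X) (ω : ℤˣ) (n : ℕ) : Set (X × ℤˣ) :=
  {g | (germMap f c ω)^[n] g = g ∧ MovesInward f n g}

theorem moveSign_of_lt {n : ℕ} {g : X × ℤˣ} (h : g.1 < f^[n] g.1) : moveSign f n g = 1 := by
  simp [moveSign, h]

theorem moveSign_of_gt {n : ℕ} {g : X × ℤˣ} (h : f^[n] g.1 < g.1) : moveSign f n g = -1 := by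
  simp [moveSign, h, h.not_gt]

open Classical in
theorem moveSign_of_fixed {n : ℕ} {g : X × ℤˣ} (h : f^[n] g.1 = g.1) :
    moveSign f n g = if MovesInward f n g then -g.2 else g.2 := by
  simp [moveSign, h]

theorem moveSign_of_dirLT {n : ℕ} {y : X} {σ τ : ℤˣ} (h : DirLT τ y (f^[n] y)) :
    moveSign f n (y, σ) = τ := by
  rcases Int.units_eq_one_or τ with rfl | rfl
  · exact moveSign_of_lt (dirLT_one.1 h)
  · exact moveSign_of_gt (dirLT_neg_one.1 h)

theorem moveSign_eq_beforeSign {n : ℕ} {u : X} (h : f^[n] u ≠ u) (σ : ℤˣ) :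
    (moveSign f n (u, σ) : ℤ) = beforeSign f c ω n u := by
  rw [beforeSign, germMap_iterate_eq]
  simp only [Before, h.symm, false_and, or_false]
  rcases lt_or_gt_of_ne h with h | h
  · rw [moveSign_of_gt h, if_neg h.not_gt]; simp
  · rw [moveSign_of_lt h, if_pos h]; simp

theorem sum_ite_attractingGerms {n : ℕ} (hfin : (Function.fixedPoints f^[n]).Finite)
    [DecidablePred (· ∈ attractingGerms f c ω n)] :
    ∑ u ∈ hfin.toFinset, ((if (u, 1) ∈ attractingGerms f c ω n then (1 : ℤ) else 0) +
      if (u, -1) ∈ attractingGerms f c ω n then 1 else 0) = (attractingGerms f c ω n).ncard := by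
  have h1 : (hfin.toFinset ×ˢ ({1, -1} : Finset ℤˣ)).filter (· ∈ attractingGerms f c ω n) =
      attractingGerms f c ω n := by
    ext ⟨u, σ⟩
    simp only [Finset.coe_filter, Finset.mem_product, Set.Finite.mem_toFinset, Set.mem_ofPred_eq,
      Finset.mem_insert, Finset.mem_singleton, and_iff_right_iff_imp]
    intro hg
    refine ⟨?_, Int.units_eq_one_or σ⟩
    have := congrArg Prod.fst hg.1
    rwa [germMap_iterate_fst] at this
  rw [← congrArg Set.ncard h1, Set.ncard_coe_finset, ← Finset.sum_boole, Finset.sum_product]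
  refine Finset.sum_congr rfl fun u _ => ?_
  rw [Finset.sum_pair (by decide)]

variable [OrderTopology X]

/-- A flipped germ throws nearby points across the base point, which is motion against its own side.
-/
theorem IsTurning.movesInward_of_not_fixed (hf : IsTurning f c ω) {n : ℕ} {g : X × ℤˣ}
    (h : f^[n] g.1 = g.1) (h' : (germMap f c ω)^[n] g ≠ g) : MovesInward f n g := by
  have ht := (hf.tendsto_side_iterate n g).eventually (eventually_side_dirLT _)
  rw [germMap_iterate_eq, iterDir_of_not_fixed h h', h, mul_neg_one] at ht
  filter_upwards [ht, eventually_side_dirLT g] with y h1 h2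
  exact (dirLT_neg.1 h1).trans h2

-- For a flipped germ, inward motion and reversed orientation cancel; only attracting germs give
-- `-1`. Hence a fixed point has jump 2 less 2 per attracting germ.
open Classical in
theorem IsTurning.iterDir_mul_moveSign (hf : IsTurning f c ω) {n : ℕ} {g : X × ℤˣ}
    (h : f^[n] g.1 = g.1) :
    g.2 * (iterDir f c ω n g * moveSign f n g) =
      if g ∈ attractingGerms f c ω n then -1 else 1 := by
  rw [moveSign_of_fixed h]
  by_cases h' : (germMap f c ω)^[n] g = g
  · rw [iterDir_of_fixed h']
    simp only [attractingGerms, Set.mem_ofPred_eq, h', true_and, one_mul]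
    split_ifs <;> simp
  · rw [iterDir_of_not_fixed h h', if_pos (hf.movesInward_of_not_fixed h h'), if_neg]
    · simp
    · exact fun hm => h' hm.1

theorem eventually_not_fixed {n : ℕ} (hfin : (Function.fixedPoints f^[n]).Finite) (g : X × ℤˣ) :
    ∀ᶠ y in side g, f^[n] y ≠ y := by
  have h1 : (Function.fixedPoints f^[n] \ {g.1})ᶜ ∈ 𝓝 g.1 :=
    hfin.sdiff.isClosed.isOpen_compl.mem_nhds (by simp)
  filter_upwards [side_le_nhds g h1, eventually_side_ne g] with y hy hyne hfix
  exact hy ⟨hfix, hyne⟩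

variable [DenselyOrdered X]

theorem isStep_moveSign (hf : Continuous f) {n : ℕ} (hfin : (Function.fixedPoints f^[n]).Finite) :
    IsStep (moveSign f n) := by
  intro g
  have hc : Continuous f^[n] := hf.iterate n
  rcases lt_trichotomy g.1 (f^[n] g.1) with h | h | h
  · rw [moveSign_of_lt h]
    filter_upwards [Eventually.filter_mono (side_le_nhds g)
      ((isOpen_lt continuous_id hc).mem_nhds h)] with y hy σ
    exact moveSign_of_lt hy
  · rw [moveSign_of_fixed h.symm]
    split_ifs with hin
    · filter_upwards [hin] with y hy σ
      exact moveSign_of_dirLT (dirLT_neg.2 hy)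
    · filter_upwards [(eventually_dirLT_or hc (eventually_not_fixed hfin g) g.2).resolve_left hin]
        with y hy σ
      exact moveSign_of_dirLT hy
  · rw [moveSign_of_gt h]
    filter_upwards [Eventually.filter_mono (side_le_nhds g)
      ((isOpen_lt hc continuous_id).mem_nhds h)] with y hy σ
    exact moveSign_of_gt hy

variable [BoundedOrder X]

/-- The number of fixed points of `f^n` in terms of the kneading data of `f`. -/
theorem IsTurning.ncard_fixedPoints (hf : IsTurning f c ω) {n : ℕ}
    (hfin : (Function.fixedPoints f^[n]).Finite) :
    ((Function.fixedPoints f^[n]).ncard : ℤ) = (attractingGerms f c ω n).ncard +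
      {u ∈ Function.fixedPoints f^[n] | ∃ i < n, f^[i] u = c}.ncard +
      2 * ∑ i ∈ Finset.range n, (iterDir f c ω (n - i) (c, -1) : ℤ) *
        hitCount f c i ((germMap f c ω)^[n - i] (c, -1)) - iterDir f c ω n (⊥, -1) := by
  classical
  -- Multiplying by the direction of motion adds jumps at the fixed points to those at preimages of
  -- `c`.
  set h : X × ℤˣ → ℤ := fun g => (iterDir f c ω n g : ℤ) * moveSign f n g with hh
  set J : X → ℤ := fun u => (iterDir f c ω n (u, 1) : ℤ) - iterDir f c ω n (u, -1) with hJ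
  have hstep : IsStep h :=
    (hf.isStep_iterDir n).map₂ (isStep_moveSign hf.continuous hfin) fun a b => (a : ℤ) * b
  have hJ0 : ∀ u ∉ hf.hitSet n, J u = 0 := by
    intro u hu
    rw [hf.mem_hitSet] at hu
    push Not at hu
    simp only [hJ]
    rw [iterDir_eq_of_not_hit hu 1 (-1), sub_self]
  have hnf : ∀ u, f^[n] u ≠ u → h (u, 1) - h (u, -1) = beforeSign f c ω n u * J u := by
    intro u hu
    simp only [hh, hJ, moveSign_eq_beforeSign (c := c) (ω := ω) hu]
    ring
  have hfx : ∀ u, f^[n] u = u → h (u, 1) - h (u, -1) =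
      2 - 2 * ((if (u, 1) ∈ attractingGerms f c ω n then (1 : ℤ) else 0) +
        if (u, -1) ∈ attractingGerms f c ω n then 1 else 0) := by
    intro u hu
    have h1 := congrArg (Units.val) (hf.iterDir_mul_moveSign (g := (u, 1)) hu)
    have h2 := congrArg (Units.val) (hf.iterDir_mul_moveSign (g := (u, -1)) hu)
    simp only [Units.val_mul, one_mul, Units.val_neg, neg_mul] at h1 h2
    simp only [hh]
    rw [sub_eq_add_neg, h1, h2]
    split_ifs <;> simp
  have hsum := hstep.sub_eq_sum (hf.hitSet n ∪ hfin.toFinset) (fun u hu => by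
    rw [Finset.mem_union, not_or, Set.Finite.mem_toFinset] at hu
    have := hnf u hu.2
    rw [hJ0 u hu.1, mul_zero] at this
    exact sub_eq_zero.1 this) (⊤, 1)
  -- The right side of `⊤` is empty, so a fixed `⊤` is vacuously inward and the sign is `-1` in
  -- every case.
  have htop : h (⊤, 1) = -iterDir f c ω n (⊤, 1) := by
    simp only [hh]
    have : moveSign f n ((⊤ : X), (1 : ℤˣ)) = -1 := by
      rcases (le_top : f^[n] (⊤ : X) ≤ ⊤).lt_or_eq with h1 | h1
      · exact moveSign_of_gt h1
      · rw [moveSign_of_fixed h1, if_pos]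
        simp [MovesInward, side_one]
    rw [this]; simp
  have hbot : h (⊥, -1) = iterDir f c ω n (⊥, -1) := by
    simp only [hh]
    have : moveSign f n ((⊥ : X), (-1 : ℤˣ)) = 1 := by
      rcases (bot_le : ⊥ ≤ f^[n] (⊥ : X)).lt_or_eq with h1 | h1
      · exact moveSign_of_lt h1
      · rw [moveSign_of_fixed h1.symm, if_pos]
        · simp
        · simp [MovesInward, side_neg_one]
    rw [this]; simp
  have hfilter : (hf.hitSet n ∪ hfin.toFinset).filter (Before · ((⊤ : X), (1 : ℤˣ))) =
      hf.hitSet n ∪ hfin.toFinset := Finset.filter_true_of_mem fun u _ => before_one.2 le_top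
  rw [hfilter, htop, hbot] at hsum
  -- split every jump into its kneading part and its fixed point part
  have hsplit : ∀ u ∈ hf.hitSet n ∪ hfin.toFinset, h (u, 1) - h (u, -1) =
      (if u ∈ hf.hitSet n then beforeSign f c ω n u * J u else 0) +
      if u ∈ hfin.toFinset then
        (2 - 2 * ((if (u, 1) ∈ attractingGerms f c ω n then (1 : ℤ) else 0) +
          if (u, -1) ∈ attractingGerms f c ω n then 1 else 0)) -
          2 * (if ∃ i < n, f^[i] u = c then 1 else 0) else 0 := by
    intro u _
    by_cases hu : f^[n] u = u
    · rw [hfx u hu, if_pos (hfin.mem_toFinset.2 hu)]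
      -- A fixed point that meets `c` already contributes 2 through its kneading jump; the last
      -- correction removes this duplicate.
      by_cases hit : ∃ i < n, f^[i] u = c
      · rw [if_pos (hf.mem_hitSet.2 hit), if_pos hit, beforeSign_mul_jump_of_fixed hu hit]
        ring
      · rw [if_neg (mt hf.mem_hitSet.1 hit), if_neg hit]
        ring
    · rw [hnf u hu, if_neg (mt hfin.mem_toFinset.1 hu), add_zero]
      split_ifs with hit
      · rfl
      · rw [hJ0 u hit, mul_zero]
  rw [Finset.sum_congr rfl hsplit, Finset.sum_add_distrib, ← Finset.sum_filter,
    ← Finset.sum_filter, Finset.filter_mem_eq_inter, Finset.filter_mem_eq_inter,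
    Finset.union_inter_cancel_left, Finset.union_inter_cancel_right, Finset.sum_sub_distrib,
    Finset.sum_sub_distrib, ← Finset.mul_sum, ← Finset.mul_sum, sum_ite_attractingGerms hfin,
    Finset.sum_const, Finset.sum_boole, hf.sum_hitSet] at hsum
  have hO : ((hfin.toFinset.filter fun u => ∃ i < n, f^[i] u = c).card : ℤ) =
      {u ∈ Function.fixedPoints f^[n] | ∃ i < n, f^[i] u = c}.ncard := by
    rw [← Set.ncard_coe_finset]
    congr 2
    ext u; simp
  have hN : hfin.toFinset.card = (Function.fixedPoints f^[n]).ncard :=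
    (Set.ncard_eq_toFinset_card _ hfin).symm
  -- Here `beforeSign` is twice an indicator minus 1; the constant part is evaluated by the kneading
  -- identity at `⊤`.
  have hkn : ∀ i ∈ Finset.range n, ∑ u ∈ (hf.finite_firstHit i).toFinset,
      beforeSign f c ω n u * J u = -4 * ((iterDir f c ω (n - i) (c, -1) : ℤ) *
        hitCount f c i ((germMap f c ω)^[n - i] (c, -1))) +
        2 * ((iterDir f c ω (n - i) (c, -1) : ℤ) * hitCount f c i (⊤, 1)) := by
    intro i hi
    rw [hf.hitCount_eq_sum, hf.hitCount_eq_sum, Finset.mul_sum, Finset.mul_sum, Finset.mul_sum,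
      Finset.mul_sum, ← Finset.sum_add_distrib]
    refine Finset.sum_congr rfl fun u hu => ?_
    rw [Set.Finite.mem_toFinset] at hu
    simp only [hJ]
    rw [jump_iterDir_of_hit hu.1 (Finset.mem_range.1 hi), beforeSign,
      germMap_iterate_eq_of_hit hu.1 (Finset.mem_range.1 hi) 1 (-1),
      if_pos (before_one.2 (le_top : u ≤ ⊤))]
    split_ifs <;> ring
  rw [Finset.sum_congr rfl hkn, Finset.sum_add_distrib, ← Finset.mul_sum, ← Finset.mul_sum,
    hO, nsmul_eq_mul, hN] at hsum
  have hk := hf.iterDir_sub n (⊤, 1)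
  linarith

end Counting

/-! ### Attracting germs and the periodic orbit of the turning point -/

section Attracting

theorem eventually_iterate_rel {X : Type*} {l : Filter X} {φ : X → X} (hφ : Tendsto φ l l)
    {R : X → X → Prop} [IsTrans X R] (h : ∀ᶠ y in l, R (φ y) y) (k : ℕ) :
    ∀ᶠ y in l, R (φ^[k + 1] y) y := by
  induction k with
  | zero => exact h
  | succ k ih =>
    filter_upwards [h, hφ.eventually ih] with y h1 h2
    exact _root_.trans h2 h1

variable {X : Type*} [ConditionallyCompleteLinearOrder X] {f : X → X} {c : X} {ω : ℤˣ}

instance isTrans_dirLT (σ : ℤˣ) : IsTrans X (DirLT σ) := ⟨fun _ _ _ h h' => h.trans h'⟩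

theorem fixed_fst {n : ℕ} {g : X × ℤˣ} (h : (germMap f c ω)^[n] g = g) : f^[n] g.1 = g.1 := by
  rw [← germMap_iterate_fst (c := c) (ω := ω), h]

variable [TopologicalSpace X]

/-- The germs that are attracting for some iterate of `f`. -/
def allAttractingGerms (f : X → X) (c : X) (ω : ℤˣ) : Set (X × ℤˣ) :=
  {g | ∃ n, 1 ≤ n ∧ g ∈ attractingGerms f c ω n}

theorem allAttractingGerms_subset_periodicPts :
    allAttractingGerms f c ω ⊆ Function.periodicPts (germMap f c ω) := by
  rintro g ⟨n, hn, hg⟩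
  exact ⟨n, hn, hg.1⟩

variable [OrderTopology X]

theorem IsTurning.tendsto_side_of_fixed (hf : IsTurning f c ω) {n : ℕ} {g : X × ℤˣ}
    (h : (germMap f c ω)^[n] g = g) : Tendsto f^[n] (side g) (side g) := by
  simpa only [h] using hf.tendsto_side_iterate n g

theorem IsTurning.attractingGerms_mul (hf : IsTurning f c ω) {n k : ℕ} (hk : 1 ≤ k) {g : X × ℤˣ}
    (h : g ∈ attractingGerms f c ω n) : g ∈ attractingGerms f c ω (n * k) := by
  obtain ⟨j, rfl⟩ := Nat.exists_eq_add_of_le' hk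
  refine ⟨Function.IsPeriodicPt.mul_const (show Function.IsPeriodicPt _ n g from h.1) _, ?_⟩
  unfold MovesInward
  rw [Function.iterate_mul]
  exact eventually_iterate_rel (R := DirLT g.2) (hf.tendsto_side_of_fixed h.1) h.2 j

variable [DenselyOrdered X]

/-- The alternative to inward motion is outward motion, which persists under iteration along a fixed
germ. -/
theorem IsTurning.attractingGerms_of_mul (hf : IsTurning f c ω) {n k : ℕ} (hk : 1 ≤ k)
    (hfin : (Function.fixedPoints f^[n]).Finite) {g : X × ℤˣ} (hg : (germMap f c ω)^[n] g = g)
    (h : g ∈ attractingGerms f c ω (n * k)) : g ∈ attractingGerms f c ω n := by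
  obtain ⟨j, rfl⟩ := Nat.exists_eq_add_of_le' hk
  refine ⟨hg, ?_⟩
  refine (eventually_dirLT_or (hf.continuous.iterate n) (eventually_not_fixed hfin g) g.2).elim id
    fun h' => ?_
  have h2 : ∀ᶠ y in side g, DirLT (-g.2) ((f^[n])^[j + 1] y) y :=
    eventually_iterate_rel (R := DirLT (-g.2)) (hf.tendsto_side_of_fixed hg)
      (h'.mono fun y hy => dirLT_neg.2 hy) j
  have h3 := h.2
  unfold MovesInward at h3
  rw [Function.iterate_mul] at h3
  filter_upwards [h2, h3] with y h2 h3
  exact absurd h3 (dirLT_neg.1 h2).asymm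

/-- The remaining `m` steps carry the side of `F g` monotonically back to that of `g`, so outward
motion at `F g` would give outward motion at `g`. -/
theorem IsTurning.germMap_mem_attractingGerms (hf : IsTurning f c ω) {n : ℕ} (hn : 1 ≤ n)
    (hfin : (Function.fixedPoints f^[n]).Finite) {g : X × ℤˣ} (h : g ∈ attractingGerms f c ω n) :
    germMap f c ω g ∈ attractingGerms f c ω n := by
  obtain ⟨m, rfl⟩ := Nat.exists_eq_add_of_le' hn
  set F := germMap f c ω
  have hFg : F^[m + 1] (F g) = F g := by
    rw [← Function.iterate_succ_apply, Function.iterate_succ_apply', h.1]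
  have hback : F^[m] (F g) = g := by rw [← Function.iterate_succ_apply]; exact h.1
  refine ⟨hFg, ?_⟩
  refine (eventually_dirLT_or (hf.continuous.iterate _) (eventually_not_fixed hfin (F g))
    (F g).2).elim id fun h' => ?_
  have hmono := hf.eventually_dirLT m (F g)
  have ht : Tendsto (fun z => (z, f^[m + 1] z)) (side (F g)) (side (F g) ×ˢ side (F g)) :=
    tendsto_id.prodMk (hf.tendsto_side_of_fixed hFg)
  have hb := hf.tendsto_side_iterate m (F g)
  change ∀ᶠ p in side (F g) ×ˢ side (F g), DirLT (F g).2 p.1 p.2 →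
    DirLT (F^[m] (F g)).2 (f^[m] p.1) (f^[m] p.2) at hmono
  change Tendsto f^[m] (side (F g)) (side (F^[m] (F g))) at hb
  rw [hback] at hb hmono
  filter_upwards [h', ht.eventually hmono, hb.eventually h.2] with z h1 h2 h3
  refine absurd h3 (DirLT.asymm ?_)
  have := h2 h1
  rwa [← Function.iterate_add_apply, add_comm, Function.iterate_add_apply] at this

theorem IsTurning.mapsTo_allAttractingGerms (hf : IsTurning f c ω)
    (hfin : ∀ n, 1 ≤ n → (Function.fixedPoints f^[n]).Finite) :
    Set.MapsTo (germMap f c ω) (allAttractingGerms f c ω) (allAttractingGerms f c ω) := by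
  rintro g ⟨n, hn, hg⟩
  exact ⟨n, hn, hf.germMap_mem_attractingGerms hn (hfin n hn) hg⟩

/-- Attraction does not depend on the iterate, so the counts for all `n` are fixed point counts of
one system. -/
theorem IsTurning.attractingGerms_eq (hf : IsTurning f c ω)
    (hfin : ∀ n, 1 ≤ n → (Function.fixedPoints f^[n]).Finite) {n : ℕ} (hn : 1 ≤ n) :
    attractingGerms f c ω n = {g ∈ allAttractingGerms f c ω | (germMap f c ω)^[n] g = g} := by
  ext g
  constructor
  · exact fun h => ⟨⟨n, hn, h⟩, h.1⟩
  · rintro ⟨⟨m, hm, hg⟩, h⟩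
    refine hf.attractingGerms_of_mul hm (hfin n hn) h ?_
    rw [mul_comm]
    exact hf.attractingGerms_mul hn hg

theorem IsTurning.finite_allAttractingGerms [BoundedOrder X] (hf : IsTurning f c ω)
    (hrep : {x ∈ Function.periodicPts f | ¬ IsRepelling f x}.Finite) :
    (allAttractingGerms f c ω).Finite := by
  -- The endpoints are added because their empty sides can be attracting vacuously.
  refine ((hrep.union (Set.toFinite {⊥, ⊤})).prod (Set.finite_univ (α := ℤˣ))).subset ?_
  rintro g ⟨n, hn, hg⟩
  refine ⟨?_, Set.mem_univ _⟩
  by_cases h1 : g.1 = ⊥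
  · right; left; exact h1
  by_cases h2 : g.1 = ⊤
  · right; right; exact h2
  left
  have hfix : f^[n] g.1 = g.1 := fixed_fst hg.1
  refine ⟨⟨n, hn, hfix⟩, fun hr => ?_⟩
  have := side_neBot h1 h2
  exact hr.not_attracting hf.continuous hn hfix
    ((hf.tendsto_side_of_fixed hg.1).eventually (eventually_side_dirLT g)) hg.2

end Attracting

section TurningOrbit

variable {X : Type*} {f : X → X} {c : X}

/-- The periodic points whose orbit contains `c`. -/
def turningOrbit (f : X → X) (c : X) : Set X := {u ∈ Function.periodicPts f | ∃ i, f^[i] u = c}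

theorem mapsTo_turningOrbit : Set.MapsTo f (turningOrbit f c) (turningOrbit f c) := by
  rintro u ⟨⟨p, hp, hpu⟩, i, hi⟩
  obtain ⟨m, rfl⟩ := Nat.exists_eq_add_of_le' (show 1 ≤ p from hp)
  refine ⟨⟨m + 1, hp, hpu.apply⟩, i + m, ?_⟩
  rw [← Function.iterate_succ_apply, Nat.succ_eq_add_one, add_assoc, Function.iterate_add_apply,
    hpu.eq, hi]

theorem finite_turningOrbit (hfin : ∀ n, 1 ≤ n → (Function.fixedPoints f^[n]).Finite) :
    (turningOrbit f c).Finite := by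
  by_cases hc : c ∈ Function.periodicPts f
  · obtain ⟨p, hp, hpc⟩ := hc
    refine (hfin p hp).subset ?_
    rintro u ⟨⟨q, hq, hqu⟩, i, hi⟩
    -- A periodic point that reaches `c` is itself an iterate of `c`, hence fixed by every iterate
    -- fixing `c`.
    have h1 : f^[q * i - i] c = u := by
      rw [← hi, ← Function.iterate_add_apply,
        Nat.sub_add_cancel (Nat.le_mul_of_pos_left i hq)]
      exact hqu.mul_const i
    change f^[p] u = u
    rw [← h1, ← Function.iterate_add_apply, add_comm, Function.iterate_add_apply, hpc.eq]
  · convert Set.finite_empty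
    ext u
    simp only [Set.mem_empty_iff_false, iff_false]
    rintro ⟨⟨q, hq, hqu⟩, i, rfl⟩
    exact hc ⟨q, hq, hqu.apply_iterate i⟩

theorem turningOrbit_inter {n : ℕ} (hn : 1 ≤ n) :
    {u ∈ Function.fixedPoints f^[n] | ∃ i < n, f^[i] u = c} =
      {u ∈ turningOrbit f c | f^[n] u = u} := by
  ext u
  constructor
  · rintro ⟨h, i, -, hi⟩
    exact ⟨⟨⟨n, hn, h⟩, i, hi⟩, h⟩
  · rintro ⟨⟨-, i, hi⟩, h⟩
    refine ⟨h, i % n, Nat.mod_lt _ hn, ?_⟩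
    rw [← hi, Function.IsPeriodicPt.iterate_mod_apply h]

end TurningOrbit

/-! ### The zeta function of a permutation of a finite set -/

section FiniteZeta

open PowerSeries

/-- The series `∑_{n ≥ 1} N_n t^n`. -/
noncomputable def countSeries (N : ℕ → ℕ) : PowerSeries ℚ :=
  PowerSeries.mk fun n => if n = 0 then 0 else (N n : ℚ)

theorem one_sub_X_pow_mul_countSeries {p : ℕ} (hp : 0 < p) :
    (1 - X ^ p) * countSeries (fun n => if p ∣ n then p else 0) = (p : ℚ) • X ^ p := by
  ext n
  rw [sub_mul, one_mul, map_sub, coeff_X_pow_mul', coeff_smul, coeff_X_pow]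
  simp only [countSeries, coeff_mk]
  by_cases h0 : n = 0
  · subst h0; simp [hp.ne', hp.ne]
  rw [if_neg h0]
  by_cases hpn : p ≤ n
  · rw [if_pos hpn]
    obtain ⟨m, rfl⟩ := Nat.exists_eq_add_of_le hpn
    by_cases hm : m = 0
    · subst hm; simp
    · simp [hm]
  · rw [if_neg hpn, if_neg (fun h => hpn (Nat.le_of_dvd (Nat.pos_of_ne_zero h0) h)),
      if_neg (by omega)]
    simp

/-- `Z` is the product of `1 - t^p` over the cycles in `A`, `p` being the length: a cycle of length
`p` contributes `p t^p / (1 - t^p)`. -/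
theorem exists_zeta_polynomial {α : Type*} (T : α → α) {A : Set α} (hA : A.Finite)
    (hT : Set.MapsTo T A A) (hper : A ⊆ Function.periodicPts T) :
    ∃ Z : Polynomial ℚ, Z.coeff 0 = 1 ∧
      (Z : PowerSeries ℚ) * countSeries (fun n => {g ∈ A | T^[n] g = g}.ncard) =
        -(X * d⁄dX ℚ (Z : PowerSeries ℚ)) := by
  induction hk : A.ncard using Nat.strong_induction_on generalizing A with
  | _ k ih =>
  subst hk
  rcases A.eq_empty_or_nonempty with rfl | ⟨g, hg⟩
  · refine ⟨1, by simp, ?_⟩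
    ext n; simp [countSeries]
  set p := Function.minimalPeriod T g with hp
  have hp0 : 0 < p := Function.minimalPeriod_pos_of_mem_periodicPts (hper hg)
  set O : Set α := (fun i => T^[i] g) '' Set.Iio p with hO
  have hOall : ∀ i, T^[i] g ∈ O := fun i =>
    ⟨i % p, Nat.mod_lt _ hp0, Function.iterate_mod_minimalPeriod_eq⟩
  have hOA : O ⊆ A := by
    rintro _ ⟨i, -, rfl⟩
    exact hT.iterate i hg
  have hOcard : O.ncard = p := by
    rw [hO, Set.InjOn.ncard_image Function.iterate_injOn_Iio_minimalPeriod, ← Finset.coe_Iio,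
      Set.ncard_coe_finset, Nat.card_Iio]
  have hfixO : ∀ n, {x ∈ O | T^[n] x = x} = if p ∣ n then O else ∅ := by
    intro n
    have : ∀ x ∈ O, (T^[n] x = x ↔ p ∣ n) := by
      rintro _ ⟨i, -, rfl⟩
      have h1 := Function.minimalPeriod_apply_iterate (hper hg) i
      rw [hp, ← h1]
      exact Function.isPeriodicPt_iff_minimalPeriod_dvd
    split_ifs with hpn
    · ext x; exact ⟨fun h => h.1, fun h => ⟨h, (this x h).2 hpn⟩⟩
    · ext x
      simp only [Set.mem_empty_iff_false, iff_false]
      exact fun h => hpn ((this x h.1).1 h.2)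
  have hlt : (A \ O).ncard < A.ncard :=
    Set.ncard_lt_ncard ⟨Set.sdiff_subset, fun h => (h hg).2 (hOall 0)⟩ hA
  -- `A \ O` is invariant: a periodic point whose image lies in `O` is an iterate of that image.
  obtain ⟨Z, hZ0, hZ⟩ := ih _ hlt hA.sdiff (fun x hx => ⟨hT hx.1, fun hTx => hx.2 (by
    obtain ⟨q, hq, hqx⟩ := hper hx.1
    obtain ⟨m, rfl⟩ := Nat.exists_eq_add_of_le' (show 1 ≤ q from hq)
    obtain ⟨i, -, hi⟩ := hTx
    have : x = T^[m + i] g := by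
      rw [Function.iterate_add_apply]
      simp only at hi
      rw [hi, ← Function.iterate_succ_apply]
      exact hqx.symm
    rw [this]; exact hOall _)⟩) (Set.sdiff_subset.trans hper) rfl
  have hsplit : countSeries (fun n => {g ∈ A | T^[n] g = g}.ncard) =
      countSeries (fun n => {g ∈ A \ O | T^[n] g = g}.ncard) +
        countSeries (fun n => if p ∣ n then p else 0) := by
    ext n
    simp only [countSeries, map_add, coeff_mk]
    split_ifs with h0 hpn
    · simp
    all_goals
      have hu : {g ∈ A | T^[n] g = g} = {g ∈ A \ O | T^[n] g = g} ∪ {g ∈ O | T^[n] g = g} := by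
        ext x
        constructor
        · rintro ⟨h1, h2⟩
          by_cases hx : x ∈ O
          · exact Or.inr ⟨hx, h2⟩
          · exact Or.inl ⟨⟨h1, hx⟩, h2⟩
        · rintro (⟨h1, h2⟩ | ⟨h1, h2⟩)
          · exact ⟨h1.1, h2⟩
          · exact ⟨hOA h1, h2⟩
      rw [hu, Set.ncard_union_eq (Set.disjoint_left.2 fun x h1 h2 => h1.1.2 h2.1)
        (hA.sdiff.subset fun x h => h.1) ((hA.subset hOA).subset fun x h => h.1), hfixO]
      simp [hpn, hOcard]
  refine ⟨Z * (1 - Polynomial.X ^ p), ?_, ?_⟩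
  · rw [Polynomial.mul_coeff_zero, hZ0]; simp [hp0.ne]
  · have hd : X * d⁄dX ℚ ((1 : PowerSeries ℚ) - X ^ p) = -((p : ℚ) • X ^ p) := by
      obtain ⟨q, hq⟩ := Nat.exists_eq_add_of_le' (show 1 ≤ p from hp0)
      rw [map_sub, derivative_one, derivative_pow, derivative_X, hq, PowerSeries.smul_eq_C_mul]
      push_cast
      simp only [map_add, map_one, map_natCast]
      ring
    push_cast
    rw [hsplit, mul_add, Derivation.leibniz, smul_eq_mul, smul_eq_mul]
    have h1 := one_sub_X_pow_mul_countSeries hp0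
    calc _ = (1 - X ^ p) * ((Z : PowerSeries ℚ) *
            countSeries (fun n => {g ∈ A \ O | T^[n] g = g}.ncard)) +
          (Z : PowerSeries ℚ) * ((1 - X ^ p) * countSeries (fun n => if p ∣ n then p else 0)) := by
            ring
      _ = _ := by rw [hZ, h1, ← neg_eq_iff_eq_neg.2 hd]; ring

end FiniteZeta

/-! ### The zeta function and the kneading series -/

section Series

open PowerSeries Finset

/-- The sum `∑_j t^j P_j` of a sequence of power series. -/
noncomputable def shiftedSum (P : ℕ → PowerSeries ℚ) : PowerSeries ℚ :=
  PowerSeries.mk fun n => ∑ ij ∈ antidiagonal n, coeff ij.2 (P ij.1)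

theorem mul_shiftedSum (Q : PowerSeries ℚ) (P : ℕ → PowerSeries ℚ) :
    Q * shiftedSum P = shiftedSum fun j => Q * P j := by
  ext n
  simp only [shiftedSum, coeff_mul, coeff_mk, mul_sum]
  rw [sum_sigma', sum_sigma']
  -- Both sides sum over triples of exponents with total `n`; the regrouping is an involution.
  refine sum_nbij' (fun x => ⟨(x.2.1, x.1.1 + x.2.2), (x.1.1, x.2.2)⟩)
    (fun x => ⟨(x.2.1, x.1.1 + x.2.2), (x.1.1, x.2.2)⟩) ?_ ?_ ?_ ?_ ?_
  · rintro ⟨⟨a, b⟩, ⟨j, i⟩⟩ h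
    simp only [mem_sigma, HasAntidiagonal.mem_antidiagonal] at h ⊢
    exact ⟨by omega, trivial⟩
  · rintro ⟨⟨a, b⟩, ⟨j, i⟩⟩ h
    simp only [mem_sigma, HasAntidiagonal.mem_antidiagonal] at h ⊢
    exact ⟨by omega, trivial⟩
  · rintro ⟨⟨a, b⟩, ⟨j, i⟩⟩ h
    simp only [mem_sigma, HasAntidiagonal.mem_antidiagonal] at h
    obtain ⟨-, rfl⟩ := h
    rfl
  · rintro ⟨⟨a, b⟩, ⟨j, i⟩⟩ h
    simp only [mem_sigma, HasAntidiagonal.mem_antidiagonal] at h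
    obtain ⟨-, rfl⟩ := h
    rfl
  · rintro ⟨⟨a, b⟩, ⟨j, i⟩⟩ _
    rfl

variable {X : Type*} [ConditionallyCompleteLinearOrder X] {f : X → X} {c : X} {ω : ℤˣ}

/-- The kneading series of `f`: its coefficients are the directions of the iterates of `f` on the
left of the turning point. -/
noncomputable def kneadingSeries (f : X → X) (c : X) (ω : ℤˣ) : PowerSeries ℚ :=
  PowerSeries.mk fun n => ((iterDir f c ω (n + 1) (c, -1) : ℤ) : ℚ)

/-- The series of directions of the iterates of `f` along a germ. -/
noncomputable def dirSeries (f : X → X) (c : X) (ω : ℤˣ) (g : X × ℤˣ) : PowerSeries ℚ :=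
  PowerSeries.mk fun n => ((iterDir f c ω n g : ℤ) : ℚ)

/-- The series of numbers of preimages of the turning point before a germ. -/
noncomputable def hitSeries (f : X → X) (c : X) (g : X × ℤˣ) : PowerSeries ℚ :=
  PowerSeries.mk fun n => (hitCount f c n g : ℚ)

variable [TopologicalSpace X] [OrderTopology X] [DenselyOrdered X] [BoundedOrder X]

/-- The generating function of `IsTurning.iterDir_sub`; the factor `X` reflects that `n - i ≥ 1` in
that sum. -/
theorem IsTurning.dirSeries_sub (hf : IsTurning f c ω) (g : X × ℤˣ) :
    dirSeries f c ω g - dirSeries f c ω (⊥, -1) =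
      -2 * (PowerSeries.X * (kneadingSeries f c ω * hitSeries f c g)) := by
  ext n
  have h := congrArg (fun z : ℤ => (z : ℚ)) (hf.iterDir_sub n g)
  rw [show (-2 : PowerSeries ℚ) = PowerSeries.C (-2 : ℚ) by rw [map_neg, map_ofNat], coeff_C_mul]
  simp only [map_sub, dirSeries, coeff_mk]
  push_cast at h
  rw [h]
  congr 1
  cases n with
  | zero => simp
  | succ n =>
    rw [coeff_succ_X_mul, mul_comm (kneadingSeries _ _ _), coeff_mul]
    simp only [hitSeries, kneadingSeries, coeff_mk]
    rw [Finset.Nat.sum_antidiagonal_eq_sum_range_succ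
      (fun i j => (hitCount f c i g : ℚ) * ((iterDir f c ω (j + 1) (c, -1) : ℤ) : ℚ))]
    refine sum_congr rfl fun i hi => ?_
    rw [mul_comm, show n + 1 - i = n - i + 1 by have := mem_range.1 hi; omega]

/-- Weighting `IsTurning.dirSeries_sub` along the germ orbit of `c`, the chain rule turns each of
the `n + 1` products in degree `n` into `coeff n D`, and `∑ (n + 1) D_n t^n = D + t D'`. -/
theorem IsTurning.kneadingSeries_mul_shiftedSum (hf : IsTurning f c ω) :
    -2 * (PowerSeries.X * (kneadingSeries f c ω * shiftedSum fun j =>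
      coeff j (kneadingSeries f c ω) • hitSeries f c ((germMap f c ω)^[j + 1] (c, -1)))) =
      kneadingSeries f c ω + PowerSeries.X * d⁄dX ℚ (kneadingSeries f c ω) -
        kneadingSeries f c ω * dirSeries f c ω (⊥, -1) := by
  set D := kneadingSeries f c ω with hD
  have h1 : -2 * (PowerSeries.X * (D * shiftedSum fun j =>
      coeff j D • hitSeries f c ((germMap f c ω)^[j + 1] (c, -1)))) =
      shiftedSum fun j => coeff j D • (dirSeries f c ω ((germMap f c ω)^[j + 1] (c, -1)) -
        dirSeries f c ω (⊥, -1)) := by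
    rw [← mul_assoc, ← mul_assoc, mul_shiftedSum]
    congr 1
    funext j
    rw [hf.dirSeries_sub, mul_smul_comm, mul_assoc, mul_assoc]
  rw [h1]
  ext n
  have h2 : ∀ ij ∈ antidiagonal n, coeff ij.2 (coeff ij.1 D •
      (dirSeries f c ω ((germMap f c ω)^[ij.1 + 1] (c, -1)) - dirSeries f c ω (⊥, -1))) =
      coeff n D - coeff ij.1 D * coeff ij.2 (dirSeries f c ω (⊥, -1)) := by
    rintro ⟨i, j⟩ hij
    rw [HasAntidiagonal.mem_antidiagonal] at hij
    simp only at hij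
    subst hij
    rw [coeff_smul, smul_eq_mul, map_sub, mul_sub]
    congr 1
    simp only [hD, kneadingSeries, dirSeries, coeff_mk]
    rw [show i + j + 1 = i + 1 + j by omega, iterDir_add (i + 1) j]
    push_cast
    rfl
  rw [shiftedSum, coeff_mk, sum_congr rfl h2, sum_sub_distrib, ← coeff_mul, map_sub, sum_const,
    Nat.card_antidiagonal, map_add]
  congr 1
  cases n with
  | zero => simp
  | succ n => rw [coeff_succ_X_mul, coeff_derivative]; simp; ring

theorem IsTurning.kneadingSeries_mul_countSeries (hf : IsTurning f c ω)
    (hfin : ∀ n, 1 ≤ n → (Function.fixedPoints f^[n]).Finite) :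
    kneadingSeries f c ω * countSeries (fun n => (Function.fixedPoints f^[n]).ncard) =
      kneadingSeries f c ω * countSeries (fun n =>
        {g ∈ allAttractingGerms f c ω | (germMap f c ω)^[n] g = g}.ncard) +
      kneadingSeries f c ω * countSeries (fun n => {u ∈ turningOrbit f c | f^[n] u = u}.ncard) -
      PowerSeries.X * d⁄dX ℚ (kneadingSeries f c ω) := by
  set D := kneadingSeries f c ω with hD
  set P := shiftedSum fun j => coeff j D • hitSeries f c ((germMap f c ω)^[j + 1] (c, -1)) with hP
  -- The `+ 1` only repairs degree 0, where `dirSeries` has coefficient 1 and the counts are set to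
  -- 0.
  have key : countSeries (fun n => (Function.fixedPoints f^[n]).ncard) =
      countSeries (fun n => {g ∈ allAttractingGerms f c ω | (germMap f c ω)^[n] g = g}.ncard) +
      countSeries (fun n => {u ∈ turningOrbit f c | f^[n] u = u}.ncard) +
      2 * (PowerSeries.X * P) - dirSeries f c ω (⊥, -1) + 1 := by
    ext n
    rw [show (2 : PowerSeries ℚ) = PowerSeries.C (2 : ℚ) by rw [map_ofNat], map_add, map_sub,
      map_add, map_add, coeff_C_mul]
    simp only [countSeries, dirSeries, coeff_mk]
    cases n with
    | zero => simp [iterDir_zero]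
    | succ n =>
      have h := congrArg (fun z : ℤ => (z : ℚ)) (hf.ncard_fixedPoints (hfin (n + 1) (by omega)))
      rw [hf.attractingGerms_eq hfin (by omega), turningOrbit_inter (by omega)] at h
      push_cast at h
      simp only [Nat.add_eq_zero_iff, one_ne_zero, and_false, if_false]
      rw [h, coeff_succ_X_mul, coeff_one, if_neg (by omega), add_zero, hP, shiftedSum, coeff_mk,
        Finset.Nat.sum_antidiagonal_eq_sum_range_succ (fun j i => coeff i
          (coeff j D • hitSeries f c ((germMap f c ω)^[j + 1] (c, -1)))), ← sum_range_reflect]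
      congr 3
      refine sum_congr rfl fun i hi => ?_
      have hi' := mem_range.1 hi
      rw [coeff_smul, smul_eq_mul, hD, kneadingSeries, hitSeries, coeff_mk, coeff_mk,
        show n + 1 - (n + 1 - 1 - i) = i + 1 by omega, show n + 1 - 1 - i = n - i by omega]
  have h1 := hf.kneadingSeries_mul_shiftedSum
  rw [← hD, ← hP] at h1
  rw [key]
  linear_combination (-1 : PowerSeries ℚ) * h1

end Series

/-! ### The logarithmic derivative of the zeta function -/

section Zeta

open PowerSeries

variable {X : Type*} [TopologicalSpace X]

theorem isolatedFixedPts_eq [T1Space X] {f : X → X} {n : ℕ}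
    (hfin : (Function.fixedPoints f^[n]).Finite) :
    isolatedFixedPts f n = Function.fixedPoints f^[n] := by
  ext x
  refine ⟨fun h => h.1, fun h => ⟨h, (Function.fixedPoints f^[n] \ {x})ᶜ,
    hfin.sdiff.isClosed.isOpen_compl, by simp, fun y hy hfix => ?_⟩⟩
  by_contra hne
  exact hy ⟨hfix, hne⟩

theorem X_mul_derivative_logZeta (f : X → X) :
    PowerSeries.X * d⁄dX ℚ (logZeta f) = countSeries fun n => (isolatedFixedPts f n).ncard := by
  ext n
  cases n with
  | zero => simp [countSeries]
  | succ n =>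
    rw [coeff_succ_X_mul, coeff_derivative, logZeta, countSeries, coeff_mk, coeff_mk,
      if_neg (by omega), if_neg (by omega)]
    push_cast
    field_simp

theorem derivative_artinMazurZeta (f : X → X) :
    d⁄dX ℚ (artinMazurZeta f) = artinMazurZeta f * d⁄dX ℚ (logZeta f) := by
  rw [artinMazurZeta, derivative_subst (hasSubst_logZeta f), derivative_exp]

theorem constantCoeff_artinMazurZeta (f : X → X) : constantCoeff (artinMazurZeta f) = 1 := by
  have h0 : constantCoeff (logZeta f) = 0 := by
    rw [← coeff_zero_eq_constantCoeff_apply]; simp [logZeta]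
  have := constantCoeff_subst (hasSubst_logZeta f) (PowerSeries.exp ℚ)
  rw [finsum_eq_single _ 0 fun d hd => by
    rw [map_pow]
    change _ • (constantCoeff (logZeta f)) ^ d = 0
    rw [h0, zero_pow hd, smul_zero]] at this
  change MvPowerSeries.constantCoeff (artinMazurZeta f) = 1
  rw [artinMazurZeta, this]
  simp

theorem eq_C_of_X_mul_derivative_eq_zero {W : PowerSeries ℚ} (h : PowerSeries.X * d⁄dX ℚ W = 0) :
    W = PowerSeries.C (constantCoeff W) := by
  refine derivative.ext ?_ (by simp)
  rw [derivative_C]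
  exact (mul_eq_zero.1 h).resolve_left X_ne_zero

/-- From `Q F = P` one gets `P Z G = u Q`; the relation is symmetric in `F` and `G`, so this serves
both directions. -/
theorem IsRationalSeries.of_mul_eq_C {F G : PowerSeries ℚ} {Z : Polynomial ℚ} {u : ℚ} (hu : u ≠ 0)
    (h : F * G * (Z : PowerSeries ℚ) = PowerSeries.C u) (hF : IsRationalSeries F) :
    IsRationalSeries G := by
  obtain ⟨P, Q, hQ, hP⟩ := hF
  have hC : (PowerSeries.C u : PowerSeries ℚ) ≠ 0 := by
    rwa [Ne, map_eq_zero_iff _ C_injective]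
  refine ⟨Q * Polynomial.C u, P * Z, mul_ne_zero ?_ ?_, ?_⟩
  · rintro rfl
    have hF0 : F = 0 := by
      refine (mul_eq_zero.1 (hP.trans (by simp))).resolve_left ?_
      simpa using hQ
    rw [hF0, zero_mul, zero_mul] at h
    exact hC h.symm
  · rintro rfl
    rw [Polynomial.coe_zero, mul_zero] at h
    exact hC h.symm
  · rw [Polynomial.coe_mul, Polynomial.coe_mul, Polynomial.coe_C, ← h, ← hP]
    ring

variable {X : Type*} [ConditionallyCompleteLinearOrder X] [TopologicalSpace X] [OrderTopology X]
  [DenselyOrdered X] [BoundedOrder X] {f : X → X} {c : X} {ω : ℤˣ}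

/-- Up to a polynomial factor, the zeta function is the inverse of the kneading series. -/
theorem IsTurning.exists_zeta_mul_kneadingSeries (hf : IsTurning f c ω)
    (hrep : {x ∈ Function.periodicPts f | ¬ IsRepelling f x}.Finite) :
    ∃ (Z : Polynomial ℚ) (u : ℚ), u ≠ 0 ∧
      artinMazurZeta f * kneadingSeries f c ω * (Z : PowerSeries ℚ) = PowerSeries.C u := by
  have hfin : ∀ n, 1 ≤ n → (Function.fixedPoints f^[n]).Finite :=
    fun n hn => hf.finite_fixedPoints hrep hn
  obtain ⟨Z₁, hZ₁0, hZ₁⟩ := exists_zeta_polynomial (germMap f c ω)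
    (hf.finite_allAttractingGerms hrep) (hf.mapsTo_allAttractingGerms hfin)
    allAttractingGerms_subset_periodicPts
  obtain ⟨Z₂, hZ₂0, hZ₂⟩ := exists_zeta_polynomial f (finite_turningOrbit (c := c) hfin)
    mapsTo_turningOrbit fun u hu => hu.1
  have hN : countSeries (fun n => (isolatedFixedPts f n).ncard) =
      countSeries (fun n => (Function.fixedPoints f^[n]).ncard) := by
    ext n
    simp only [countSeries, coeff_mk]
    split_ifs with h0
    · rfl
    · rw [isolatedFixedPts_eq (hfin n (by omega))]
  have hlog := X_mul_derivative_logZeta f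
  rw [hN] at hlog
  have hD := hf.kneadingSeries_mul_countSeries hfin
  set D := kneadingSeries f c ω
  set ζ := artinMazurZeta f with hζ
  have hζ' : d⁄dX ℚ ζ = ζ * d⁄dX ℚ (logZeta f) := derivative_artinMazurZeta f
  refine ⟨Z₁ * Z₂, constantCoeff (ζ * D * ((Z₁ * Z₂ : Polynomial ℚ) : PowerSeries ℚ)), ?_,
    eq_C_of_X_mul_derivative_eq_zero ?_⟩
  · have h1 : constantCoeff D = ((iterDir f c ω 1 (c, -1) : ℤ) : ℚ) := by
      rw [← coeff_zero_eq_constantCoeff_apply]; simp [D, kneadingSeries]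
    rw [map_mul, map_mul, hζ, constantCoeff_artinMazurZeta, h1, Polynomial.constantCoeff_coe,
      Polynomial.mul_coeff_zero, hZ₁0, hZ₂0]
    simp
  · rw [Polynomial.coe_mul]
    simp only [Derivation.leibniz, smul_eq_mul, hζ']
    -- By Leibniz the logarithmic derivatives of `ζ`, `D`, `Z₁` and `Z₂` add up, and the four
    -- identities make them cancel.
    linear_combination (ζ * D * Z₁ * Z₂ : PowerSeries ℚ) * hlog + (ζ * Z₁ * Z₂ : PowerSeries ℚ) * hD
      + (ζ * D * Z₂ : PowerSeries ℚ) * hZ₁ + (ζ * D * Z₁ : PowerSeries ℚ) * hZ₂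

theorem IsTurning.isRationalSeries_artinMazurZeta_iff (hf : IsTurning f c ω)
    (hrep : {x ∈ Function.periodicPts f | ¬ IsRepelling f x}.Finite) :
    IsRationalSeries (artinMazurZeta f) ↔ IsRationalSeries (kneadingSeries f c ω) := by
  obtain ⟨Z, u, hu, h⟩ := hf.exists_zeta_mul_kneadingSeries hrep
  exact ⟨IsRationalSeries.of_mul_eq_C hu h,
    IsRationalSeries.of_mul_eq_C hu (by rwa [mul_comm (kneadingSeries f c ω)])⟩

end Zeta

/-! ### Rational series with finitely many coefficients -/

section EventuallyPeriodic

/-- The sequence `a` is eventually periodic. -/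
def EventuallyPeriodic {α : Type*} (a : ℕ → α) : Prop :=
  ∃ p, 1 ≤ p ∧ ∃ n₀, ∀ n ≥ n₀, a (n + p) = a n

theorem EventuallyPeriodic.isRationalSeries {a : ℕ → ℚ} (h : EventuallyPeriodic a) :
    IsRationalSeries (PowerSeries.mk a) := by
  obtain ⟨p, hp, n₀, hn₀⟩ := h
  set F : PowerSeries ℚ := PowerSeries.mk a
  -- Multiplication by `1 - X^p` kills all coefficients from degree `n₀ + p` on.
  refine ⟨PowerSeries.trunc (n₀ + p) ((1 - PowerSeries.X ^ p) * F), 1 - Polynomial.X ^ p, ?_, ?_⟩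
  · intro h
    have := congrArg (Polynomial.coeff · 0) h
    simp [show ¬ 0 = p by omega] at this
  · ext n
    rw [Polynomial.coeff_coe, PowerSeries.coeff_trunc]
    push_cast
    split_ifs with hn
    · rfl
    · obtain ⟨m, rfl⟩ : ∃ m, n = m + p := ⟨n - p, by omega⟩
      rw [sub_mul, one_mul, map_sub, PowerSeries.coeff_X_pow_mul]
      simp only [F, PowerSeries.coeff_mk]
      rw [hn₀ m (by omega), sub_self]

/-- A sequence taking finitely many values and determined by its past is eventually periodic. -/
theorem eventuallyPeriodic_of_window {α : Type*} {a : ℕ → α} {S : Set α} (hS : S.Finite)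
    (haS : ∀ n, a n ∈ S) (d n₀ : ℕ)
    (hrec : ∀ m ≥ n₀, ∀ n ≥ n₀, (∀ i < d, a (m + i) = a (n + i)) → a (m + d) = a (n + d)) :
    EventuallyPeriodic a := by
  have hfin : {s : Fin d → α | ∀ i, s i ∈ S}.Finite := Set.Finite.pi' fun _ => hS
  obtain ⟨m, hm, n, hn, hne, heq⟩ := (Set.Ici_infinite n₀).exists_ne_map_eq_of_mapsTo
    (f := fun n (i : Fin d) => a (n + i)) (t := {s | ∀ i, s i ∈ S}) (fun n _ i => haS _) hfin
  wlog hlt : m < n generalizing m n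
  · exact this n hn m hm hne.symm heq.symm (by omega)
  have key : ∀ k, ∀ i < d, a (m + k + i) = a (n + k + i) := by
    intro k
    induction k with
    | zero => exact fun i hi => congrFun heq ⟨i, hi⟩
    | succ k ih =>
      intro i hi
      rcases Nat.lt_or_ge (i + 1) d with h | h
      · have := ih (i + 1) h
        rwa [show m + (k + 1) + i = m + k + (i + 1) by ring,
          show n + (k + 1) + i = n + k + (i + 1) by ring]
      · have := hrec (m + k) (le_trans hm (by omega)) (n + k) (le_trans hn (by omega)) ih
        rwa [show m + (k + 1) + i = m + k + d by omega, show n + (k + 1) + i = n + k + d by omega]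
  refine ⟨n - m, by omega, m + d, fun N hN => ?_⟩
  have := hrec (m + (N - d - m)) (le_trans hm (by omega)) (n + (N - d - m)) (le_trans hn (by omega))
    (key _)
  rw [show N + (n - m) = n + (N - d - m) + d by omega, ← this]
  congr 1
  omega

theorem IsRationalSeries.eventuallyPeriodic {a : ℕ → ℚ} {S : Set ℚ} (hS : S.Finite)
    (haS : ∀ n, a n ∈ S) (h : IsRationalSeries (PowerSeries.mk a)) : EventuallyPeriodic a := by
  obtain ⟨P, Q, hQ, hPQ⟩ := h
  -- `Q` may vanish at 0, so the recurrence is solved for its newest term using the lowest nonzero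
  -- coefficient of `Q`.
  set v := Q.natTrailingDegree
  set d := Q.natDegree - v
  have hv : v ≤ Q.natDegree := Q.natTrailingDegree_le_natDegree
  have hqv : Q.coeff v ≠ 0 := Polynomial.trailingCoeff_nonzero_iff_nonzero.2 hQ
  -- the recurrence satisfied by the coefficients
  have hrec : ∀ n, P.natDegree < n + d + v →
      ∑ i ∈ Finset.range (d + 1), Q.coeff (v + (d - i)) * a (n + i) = 0 := by
    intro n hn
    have h := congrArg (PowerSeries.coeff (n + d + v)) hPQ
    rw [Polynomial.coeff_coe, Polynomial.coeff_eq_zero_of_natDegree_lt hn, PowerSeries.coeff_mul,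
      Finset.Nat.sum_antidiagonal_eq_sum_range_succ
        (fun i j => PowerSeries.coeff i (Q : PowerSeries ℚ) *
          PowerSeries.coeff j (PowerSeries.mk a))] at h
    simp only [Polynomial.coeff_coe, PowerSeries.coeff_mk] at h
    rw [← h, ← Finset.sum_range_reflect]
    refine Finset.sum_bij_ne_zero (fun j _ _ => v + j) ?_ ?_ ?_ ?_
    · intro j hj _
      simp only [Finset.mem_range] at hj ⊢
      omega
    · intro j _ _ k _ _ h
      omega
    · intro k hk hne
      have hq : Q.coeff k ≠ 0 := left_ne_zero_of_mul hne
      have h1 : v ≤ k := Polynomial.natTrailingDegree_le_of_ne_zero hq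
      have h2 : k ≤ Q.natDegree := Polynomial.le_natDegree_of_ne_zero hq
      refine ⟨k - v, Finset.mem_range.2 (by omega), ?_, by omega⟩
      rw [show v + (d - (d + 1 - 1 - (k - v))) = k by omega,
        show n + (d + 1 - 1 - (k - v)) = n + d + v - k by omega]
      exact hne
    · intro j hj _
      have := Finset.mem_range.1 hj
      rw [show v + (d - (d + 1 - 1 - j)) = v + j by omega,
        show n + (d + 1 - 1 - j) = n + d + v - (v + j) by omega]
  refine eventuallyPeriodic_of_window hS haS d (P.natDegree + 1) fun m hm n hn hwin => ?_
  have h1 := hrec m (by omega)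
  have h2 := hrec n (by omega)
  rw [Finset.sum_range_succ] at h1 h2
  rw [Finset.sum_congr rfl fun i hi => by rw [hwin i (Finset.mem_range.1 hi)]] at h1
  have h3 : Q.coeff (v + (d - d)) * a (m + d) = Q.coeff (v + (d - d)) * a (n + d) := by linarith
  rw [Nat.sub_self, add_zero] at h3
  exact mul_left_cancel₀ hqv h3

end EventuallyPeriodic

/-! ### Periodicity of the kneading sequence -/

section Kneading

variable {X : Type*} [ConditionallyCompleteLinearOrder X] {f : X → X} {c : X} {ω : ℤˣ}

theorem iterDir_succ_right (n : ℕ) (g : X × ℤˣ) :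
    iterDir f c ω (n + 1) g = iterDir f c ω n g * dir c ω ((germMap f c ω)^[n] g) := by
  rw [iterDir_add, iterDir_one]

/-- Advancing by `p` multiplies the orientation by a fixed sign `η`; since `η² = 1`, the period `2 *
p` works. -/
theorem eventuallyPeriodic_iterDir_of_dir {g : X × ℤˣ} {p n₀ : ℕ} (hp : 1 ≤ p)
    (h : ∀ n ≥ n₀, dir c ω ((germMap f c ω)^[n + p] g) = dir c ω ((germMap f c ω)^[n] g)) :
    EventuallyPeriodic fun n => iterDir f c ω n g := by
  set η := iterDir f c ω (n₀ + p) g * iterDir f c ω n₀ g with hη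
  have key : ∀ k, iterDir f c ω (n₀ + k + p) g = η * iterDir f c ω (n₀ + k) g := by
    intro k
    induction k with
    | zero => rw [hη, add_zero, mul_assoc, units_sq, mul_one]
    | succ k ih =>
      rw [show n₀ + (k + 1) + p = n₀ + k + p + 1 by ring, iterDir_succ_right, ih,
        h _ (by omega), ← add_assoc, iterDir_succ_right, mul_assoc]
  refine ⟨2 * p, by omega, n₀, fun n hn => ?_⟩
  obtain ⟨k, rfl⟩ := Nat.exists_eq_add_of_le hn
  simp only
  rw [show n₀ + k + 2 * p = n₀ + (k + p) + p by ring, key, ← add_assoc, key, ← mul_assoc, units_sq,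
    one_mul]

/-- The germ orbit stays in a finite set and each germ determines the next. -/
theorem eventuallyPeriodic_iterDir_of_mem_periodicPts (hc : c ∈ Function.periodicPts f)
    (σ : ℤˣ) : EventuallyPeriodic fun n => iterDir f c ω n (c, σ) := by
  obtain ⟨p, hp, hpc⟩ := hc
  have hS : (((fun n => f^[n] c) '' {n | n < p}) ×ˢ (Set.univ : Set ℤˣ)).Finite :=
    ((Set.finite_lt_nat p).image _).prod Set.finite_univ
  obtain ⟨q, hq, n₀, h⟩ := eventuallyPeriodic_of_window
    (a := fun n => (germMap f c ω)^[n] (c, σ)) hS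
    (fun n => ⟨⟨n % p, Nat.mod_lt _ hp, by
      simp only [germMap_iterate_fst]; exact hpc.iterate_mod_apply n⟩, Set.mem_univ _⟩) 1 0
    (fun m _ n _ h => by
      have := h 0 one_pos
      simp only [add_zero] at this
      rw [Function.iterate_succ_apply', this, ← Function.iterate_succ_apply' (germMap f c ω)])
  refine ⟨q, hq, n₀, fun n hn => ?_⟩
  exact congrArg (fun g => σ * g.2) (h n hn)

variable [TopologicalSpace X] [OrderTopology X]

/-- If `c` is not periodic, the limit cycle avoids `c`, so nearby points of the orbit lie on the
same side of `c` as the cycle. -/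
theorem eventuallyPeriodic_iterDir_of_asymptotic (hf : Continuous f)
    (h : IsAsymptoticToPeriodicOrbit f c) (σ : ℤˣ) :
    EventuallyPeriodic fun n => iterDir f c ω n (c, σ) := by
  by_cases hc : c ∈ Function.periodicPts f
  · exact eventuallyPeriodic_iterDir_of_mem_periodicPts hc σ
  obtain ⟨x, hx, m, hlim⟩ := h
  set p := Function.minimalPeriod f x
  have hp : 0 < p := Function.minimalPeriod_pos_of_mem_periodicPts hx
  have hne : ∀ j, f^[j] x ≠ c := by
    rintro j rfl
    obtain ⟨q, hq, hqx⟩ := hx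
    exact hc ⟨q, hq, hqx.apply_iterate j⟩
  have hev : ∀ᶠ k in atTop, ∀ j ∈ Finset.range p,
      dir c ω ((germMap f c ω)^[k * p + m + j] (c, σ)) = dir c ω (f^[j] x, 1) := by
    rw [Filter.eventually_all_finset]
    intro j _
    have hj : Tendsto (fun k => f^[k * p + m + j] c) atTop (𝓝 (f^[j] x)) := by
      have := ((hf.iterate j).tendsto x).comp hlim
      refine this.congr fun k => ?_
      rw [Function.comp_apply, ← Function.iterate_add_apply, add_comm]
    rcases lt_or_gt_of_ne (hne j) with hlt | hlt
    · filter_upwards [hj.eventually (eventually_lt_nhds hlt)] with k hk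
      rw [germMap_iterate_eq, dir_of_lt hk, dir_of_lt hlt]
    · filter_upwards [hj.eventually (eventually_gt_nhds hlt)] with k hk
      rw [germMap_iterate_eq, dir_of_gt hk, dir_of_gt hlt]
  obtain ⟨K, hK⟩ := eventually_atTop.1 hev
  refine eventuallyPeriodic_iterDir_of_dir (p := p) (n₀ := K * p + m) hp fun n hn => ?_
  have hdiv := Nat.div_add_mod (n - m) p
  have hmod := Nat.mod_lt (n - m) hp
  have hKk : K ≤ (n - m) / p := (Nat.le_div_iff_mul_le hp).2 (by omega)
  have h1 : n = (n - m) / p * p + m + (n - m) % p := by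
    rw [mul_comm ((n - m) / p) p]; omega
  have h2 : n + p = ((n - m) / p + 1) * p + m + (n - m) % p := by
    rw [add_mul, one_mul]; omega
  rw [h2, hK _ (by omega) _ (Finset.mem_range.2 hmod)]
  conv_rhs => rw [h1]
  rw [hK _ hKk _ (Finset.mem_range.2 hmod)]

/-- `P` is a multiple `p * q` of the minimal period; continuity of the first `q` iterates of `f^p`
fills in the missing times. -/
theorem isAsymptotic_of_tendsto {X : Type*} [TopologicalSpace X] {f : X → X} (hf : Continuous f)
    {c x : X} {P m : ℕ} (hP : 1 ≤ P) (hx : f^[P] x = x)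
    (hlim : Tendsto (fun k => f^[m + k * P] c) atTop (𝓝 x)) : IsAsymptoticToPeriodicOrbit f c := by
  refine ⟨x, ⟨P, hP, hx⟩, m, ?_⟩
  set p := Function.minimalPeriod f x
  have hpx : f^[p] x = x := Function.isPeriodicPt_minimalPeriod f x
  obtain ⟨q, rfl⟩ : p ∣ P := Function.IsPeriodicPt.minimalPeriod_dvd hx
  have hq : 0 < q := Nat.pos_of_ne_zero (by rintro rfl; simp at hP)
  intro U hU
  obtain ⟨V, hV, hVU⟩ := exists_nhds_forall_iterate_mem hf hpx q hU
  have := (hlim.comp (Nat.tendsto_div_const_atTop hq.ne')).eventually_mem hV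
  rw [mem_map]
  filter_upwards [this] with k hk
  change f^[k * p + m] c ∈ U
  have := hVU _ hk (k % q) (Nat.mod_lt _ hq)
  rw [Function.comp_apply, ← Function.iterate_add_apply] at this
  have he : p * (k % q) + (m + k / q * (p * q)) = k * p + m := by
    have := Nat.div_add_mod k q
    calc p * (k % q) + (m + k / q * (p * q)) = p * (q * (k / q) + k % q) + m := by ring
      _ = k * p + m := by rw [this]; ring
  rwa [he] at this

/-- Points of the orbit `P` steps apart eventually share a branch, so their order evolves by the
known orientation and the orbit sampled every `P` steps is monotone. -/
theorem IsTurning.asymptotic_of_eventuallyPeriodic [BoundedOrder X] (hf : IsTurning f c ω) {σ : ℤˣ}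
    (h : EventuallyPeriodic fun n => iterDir f c ω n (c, σ)) :
    IsAsymptoticToPeriodicOrbit f c := by
  obtain ⟨P, hP, n₀, hper⟩ := h
  simp only at hper
  set d : ℕ → ℤˣ := fun n => dir c ω ((germMap f c ω)^[n] (c, σ)) with hd
  set θ : ℕ → ℤˣ := fun n => iterDir f c ω n (c, σ) with hθ
  have hθs : ∀ n, θ (n + 1) = θ n * d n := fun n => iterDir_succ_right n _
  have hdP : ∀ n ≥ n₀, d (n + P) = d n := by
    intro n hn
    have h1 := hθs (n + P)
    rw [show n + P + 1 = n + 1 + P by ring] at h1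
    have h2 : θ (n + 1) = θ n * d (n + P) := by
      rw [← show θ (n + 1 + P) = θ (n + 1) from hper _ (by omega), h1,
        show θ (n + P) = θ n from hper _ hn]
    rw [hθs] at h2
    exact (mul_left_cancel h2).symm
  have hbr : ∀ n, f^[n] c ∈ branch c ω (d n) := by
    intro n
    have := mem_branch_dir (c := c) (ω := ω) ((germMap f c ω)^[n] (c, σ))
    rwa [germMap_iterate_fst] at this
  have hstep : ∀ τ, ∀ n ≥ n₀, DirLT τ (f^[n] c) (f^[n + P] c) →
      ∀ j, DirLT (τ * (θ n * θ (n + j))) (f^[n + j] c) (f^[n + j + P] c) := by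
    intro τ n hn h j
    induction j with
    | zero => simpa [units_sq] using h
    | succ j ih =>
      have hb := hbr (n + j + P)
      rw [hdP _ (by omega)] at hb
      have := hf.dirLT (hbr (n + j)) hb ih
      rw [← Function.iterate_succ_apply' f, ← Function.iterate_succ_apply' f] at this
      rw [← add_assoc, hθs, ← mul_assoc (θ n), ← mul_assoc τ]
      rwa [show n + j + 1 + P = n + j + P + 1 by ring]
  set y : ℕ → X := fun k => f^[n₀ + k * P] c with hy
  have hys : ∀ k, f^[P] (y k) = y (k + 1) := by
    intro k
    simp only [hy]
    rw [← Function.iterate_add_apply, show P + (n₀ + k * P) = n₀ + (k + 1) * P by ring]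
  have hdir : ∀ τ, DirLT τ (y 0) (y 1) → ∀ k, DirLT τ (y k) (y (k + 1)) := by
    intro τ h k
    induction k with
    | zero => exact h
    | succ k ih =>
      have h1 := hstep τ (n₀ + k * P) (by omega) (by
        simpa only [hy, add_mul, one_mul, ← add_assoc] using ih) P
      -- The net orientation over a full period is `θ_n θ_{n+P} = 1`, so the order of consecutive
      -- samples is kept.
      rw [show θ (n₀ + k * P + P) = θ (n₀ + k * P) from hper _ (by omega), units_sq, mul_one] at h1
      simpa only [hy, add_mul, one_mul, ← add_assoc] using h1
  have hlim : ∃ x, Tendsto y atTop (𝓝 x) := by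
    rcases lt_trichotomy (y 0) (y 1) with h | h | h
    · exact ⟨_, tendsto_atTop_ciSup
        (monotone_nat_of_le_succ fun k => (dirLT_one.1 (hdir 1 (dirLT_one.2 h) k)).le)
        (OrderTop.bddAbove _)⟩
    · refine ⟨y 0, ?_⟩
      have : y = fun _ => y 0 := by
        funext k
        induction k with
        | zero => rfl
        | succ k ih => rw [← hys, ih, hys, h]
      rw [this]; exact tendsto_const_nhds
    · exact ⟨_, tendsto_atTop_ciInf
        (antitone_nat_of_succ_le fun k => (dirLT_neg_one.1 (hdir (-1) (dirLT_neg_one.2 h) k)).le)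
        (OrderBot.bddBelow _)⟩
  obtain ⟨x, hx⟩ := hlim
  refine isAsymptotic_of_tendsto hf.continuous hP ?_ hx
  refine tendsto_nhds_unique (((hf.continuous.iterate P).tendsto x).comp hx) ?_
  exact ((tendsto_add_atTop_iff_nat 1).2 hx).congr fun k => (hys k).symm

theorem IsTurning.isRationalSeries_kneadingSeries_iff [BoundedOrder X] (hf : IsTurning f c ω) :
    IsRationalSeries (kneadingSeries f c ω) ↔ IsAsymptoticToPeriodicOrbit f c := by
  constructor
  · intro h
    obtain ⟨p, hp, n₀, hper⟩ := h.eventuallyPeriodic (S := {1, -1}) (Set.toFinite _) (fun n => by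
      rcases Int.units_eq_one_or (iterDir f c ω (n + 1) (c, -1)) with h | h <;> simp [h])
    -- Coefficient `k` of the kneading series is the orientation of iterate `k + 1`, whence the
    -- threshold `n₀ + 1`.
    refine hf.asymptotic_of_eventuallyPeriodic (σ := -1) ⟨p, hp, n₀ + 1, fun n hn => ?_⟩
    obtain ⟨k, rfl⟩ := Nat.exists_eq_add_of_le' (show 1 ≤ n by omega)
    have := hper k (by omega)
    rw [Int.cast_inj, Units.val_inj] at this
    simp only
    rw [← this]
    congr 1
    ring
  · intro h
    obtain ⟨p, hp, n₀, hper⟩ :=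
      eventuallyPeriodic_iterDir_of_asymptotic (ω := ω) hf.continuous h (-1)
    refine EventuallyPeriodic.isRationalSeries ⟨p, hp, n₀, fun n hn => ?_⟩
    have := hper (n + 1) (by omega)
    simp only at this
    simp only
    rw [← this, show n + p + 1 = n + 1 + p by ring]

end Kneading

end IntervalZeta

/-! ### Unimodal maps of a compact interval -/

theorem mainTheorem3 {a b : ℝ} (f : Set.Icc a b → Set.Icc a b) (c : Set.Icc a b)
    (hf : IntervalZeta.IsUnimodal f c)
    (hrep : {x ∈ Function.periodicPts f | ¬ IntervalZeta.IsRepelling f x}.Finite) :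
    (∀ n : ℕ, 1 ≤ n → (Function.fixedPoints f^[n]).Finite) ∧
      (IntervalZeta.IsRationalSeries (IntervalZeta.artinMazurZeta f) ↔
        IntervalZeta.IsAsymptoticToPeriodicOrbit f c) := by
  have : Fact (a ≤ b) := ⟨hf.left_lt.le.trans hf.lt_right.le⟩
  let _ : Inhabited (Set.Icc a b) := ⟨c⟩
  obtain ⟨ω, hω⟩ : ∃ ω, IntervalZeta.IsTurning f c ω := by
    rcases hf.monotone_pieces with ⟨h1, h2⟩ | ⟨h1, h2⟩
    · refine ⟨1, hf.continuous, fun x y hxy hy => ?_, fun x y hx hxy => ?_⟩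
      · exact IntervalZeta.dirLT_one.2 (h1 (hxy.le.trans hy) hy hxy)
      · exact IntervalZeta.dirLT_neg_one.2 (h2 hx (hx.trans hxy.le) hxy)
    · refine ⟨-1, hf.continuous, fun x y hxy hy => ?_, fun x y hx hxy => ?_⟩
      · exact IntervalZeta.dirLT_neg_one.2 (h1 (hxy.le.trans hy) hy hxy)
      · rw [neg_neg]
        exact IntervalZeta.dirLT_one.2 (h2 hx (hx.trans hxy.le) hxy)
  exact ⟨fun n hn => hω.finite_fixedPoints hrep hn,
    (hω.isRationalSeries_artinMazurZeta_iff hrep).trans hω.isRationalSeries_kneadingSeries_iff⟩
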